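/- Let $(x_n)_{n\in\mathbb{Z}}$ be a strictly increasing sequence of real numbers without accumulation point in $\mathbb{R}$, with $x_0=0$, and let $(b_n)_{n\in\mathbb{Z}}$ be positive real numbers. Put $a_n=x_n-x_{n-1}$ and let $$\mathscr{M}_x=\mathbb{C}\setminus\bigcup_{n\in\mathbb{Z}}\{x_n+iy : y\in\mathbb{R},\ |y|\ge b_n\}$$ be the associated comb domain. Suppose that $$\ell=\sup_{n\in\mathbb{Z}}\frac{\max(b_{n-1},b_{n+1})}{\min(a_n,a_{n+1})}<\infty .$$ Then there is a number $\theta_0\in(0,1)$, depending only on $\ell$, such that for every $p\in(0,\infty)$: if $$\sum_{j=1}^\infty\Bigl(\max_{|n|\le j}a_n^2\Bigr)\theta_0^{\,j/p}<\infty,$$ then $E_z\bigl(\tau_{\mathscr{M}_x}^p\bigr)<\infty$ for every $z\in\mathscr{M}_x$, where $\tau_{\mathscr{M}_x}=\inf\{t\ge 0: Z_t\notin\mathscr{M}_x\}$ is the exit time from $\mathscr{M}_x$ of a planar Brownian motion $(Z_t)_{t\ge0}$ started at $z$ under $P_z$. -/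

import Mathlib

open MeasureTheory ProbabilityTheory Filter Topology
open scoped NNReal ENNReal

noncomputable section

namespace Comb

/-- The pair of vertical half-lines `{xₙ} × ([bₙ, ∞) ∪ (-∞, -bₙ])`. -/
def slit (x b : ℤ → ℝ) (n : ℤ) : Set ℂ :=
  {z : ℂ | z.re = x n ∧ (b n ≤ z.im ∨ z.im ≤ -b n)}

/-- The comb domain `ℂ \ ⋃ₙ Iₙ`. -/
def domain (x b : ℤ → ℝ) : Set ℂ :=
  (⋃ n : ℤ, slit x b n)ᶜ

/-- The data of a comb domain: an increasing two-sided sequence of distinct reals without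
accumulation point in `ℝ`, and positive slit heights. -/
structure IsComb (x b : ℤ → ℝ) : Prop where
  strictMono : StrictMono x
  not_accPt : ∀ c : ℝ, ¬ AccPt c (𝓟 (Set.range x))
  pos : ∀ n : ℤ, 0 < b n

/-- `aₙ = xₙ - xₙ₋₁`. -/
def gap (x : ℤ → ℝ) (n : ℤ) : ℝ := x n - x (n - 1)

/-- `max(bₙ₋₁, bₙ₊₁) / min(aₙ, aₙ₊₁)`. -/
def ratio (x b : ℤ → ℝ) (n : ℤ) : ℝ :=
  max (b (n - 1)) (b (n + 1)) / min (gap x n) (gap x (n + 1))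

/-- `max_{|n| ≤ j} aₙ²`. -/
def maxGapSq (x : ℤ → ℝ) (j : ℕ) : ℝ :=
  (Finset.Icc (-(j : ℤ)) (j : ℤ)).sup' ⟨0, by simp⟩ fun n ↦ gap x n ^ 2

/-- `Z` is a planar Brownian motion started at `z`: the real and imaginary parts of `Z - z` are
independent standard real Brownian motions. -/
structure IsPlanarBrownian {Ω : Type*} [MeasurableSpace Ω] (Z : ℝ≥0 → Ω → ℂ) (z : ℂ)
    (P : Measure Ω) : Prop where
  re : IsBrownianReal (fun t ω ↦ (Z t ω - z).re) P
  im : IsBrownianReal (fun t ω ↦ (Z t ω - z).im) P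
  indep : IndepFun (fun ω t ↦ (Z t ω - z).re) (fun ω t ↦ (Z t ω - z).im) P

/-- The exit time `inf {t ≥ 0 : Z t ∉ U}`, equal to `∞` if `Z` never leaves `U`. -/
def exitTime {Ω : Type*} (Z : ℝ≥0 → Ω → ℂ) (U : Set ℂ) (ω : Ω) : ℝ≥0∞ :=
  hittingAfter Z Uᶜ 0 ω

end Comb

end

namespace Comb

/-! Watch the real part travel from one slit abscissa to the next. Passing from `x n` to a neighbour
inside the domain, the path has height below `b` at both ends, hence below `ℓ * m` with `m = min
(gap x n) (gap x (n + 1))`, so its height changes by less than `2 * ℓ * m`. With probability at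
least 1/2 the real part does not leave within time `m ^ 2 / 32`. The imaginary part is independent
of it, so at any later exit its displacement is at least `2 * ℓ * m` with probability bounded below
in terms of `ℓ` (`measure_firstExit_le`). Each passage thus has probability at most `passBound ℓ <
1`, and the strong Markov property (`after_cond`) multiplies these bounds: `k` passages have
probability at most `passBound ℓ ^ k` (`measure_crosses_le`).

On the other hand, a linear Brownian motion stays in an interval of width `L` during time `N * L ^
2` with probability at most `γ ^ N`, where `γ < 1` is the normal mass of `(-1, 1)`. Summability
bounds the maximal squared gap by `C * θ ^ (-j / p)`, so the window around `k + 1` slits on each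
side has squared width of order at most `k ^ 2 * θ ^ (-k / p)`. For `t k` of order `k ^ 3 * θ ^ (-k
/ p)` this gives `P (τ > t k) ≤ 2 * rate ℓ ^ k`. With `θ ^ 2 = rate ℓ`, the terms `t (k + 1) ^ p * P
(τ > t k)` are of order at most `k ^ (3 * p) * θ ^ k`, which is summable. -/

/-! ### Planar Brownian motion with continuous paths -/

theorem indepFun_prodMk_prodMk_of_indepFun {Ω α₁ α₂ β₁ β₂ : Type*} [MeasurableSpace Ω]
    [MeasurableSpace α₁] [MeasurableSpace α₂] [MeasurableSpace β₁] [MeasurableSpace β₂]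
    {P : Measure Ω} [IsProbabilityMeasure P] {A₁ : Ω → α₁} {A₂ : Ω → α₂} {B₁ : Ω → β₁}
    {B₂ : Ω → β₂} (mA₁ : Measurable A₁) (mA₂ : Measurable A₂) (mB₁ : Measurable B₁)
    (mB₂ : Measurable B₂) (hA : IndepFun A₁ A₂ P) (hB : IndepFun B₁ B₂ P)
    (hAB : IndepFun (fun ω ↦ (A₁ ω, A₂ ω)) (fun ω ↦ (B₁ ω, B₂ ω)) P) :
    IndepFun (fun ω ↦ (A₁ ω, B₁ ω)) (fun ω ↦ (A₂ ω, B₂ ω)) P := by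
  have hA₁B₁ : IndepFun A₁ B₁ P := hAB.comp measurable_fst measurable_fst
  have hA₂B₂ : IndepFun A₂ B₂ P := hAB.comp measurable_snd measurable_snd
  rw [IndepFun_iff_Indep, ← generateFrom_prod, ← generateFrom_prod,
    MeasurableSpace.comap_generateFrom, MeasurableSpace.comap_generateFrom]
  refine IndepSets.indep' ?_ ?_ ?_ ?_ ?_
  · rintro _ ⟨_, ⟨s, hs, t, ht, rfl⟩, rfl⟩
    exact (mA₁.prodMk mB₁) (hs.prod ht)
  · rintro _ ⟨_, ⟨s, hs, t, ht, rfl⟩, rfl⟩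
    exact (mA₂.prodMk mB₂) (hs.prod ht)
  · exact isPiSystem_prod.comap _
  · exact isPiSystem_prod.comap _
  · rw [IndepSets_iff]
    rintro _ _ ⟨_, ⟨s, hs, t, ht, rfl⟩, rfl⟩ ⟨_, ⟨s', hs', t', ht', rfl⟩, rfl⟩
    have e₁ := hA.measure_inter_preimage_eq_mul s s' hs hs'
    have e₂ := hB.measure_inter_preimage_eq_mul t t' ht ht'
    have e₃ := hAB.measure_inter_preimage_eq_mul _ _ (hs.prod hs') (ht.prod ht')
    have e₄ := hA₁B₁.measure_inter_preimage_eq_mul s t hs ht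
    have e₅ := hA₂B₂.measure_inter_preimage_eq_mul s' t' hs' ht'
    simp only [Set.mk_preimage_prod] at *
    rw [e₁, e₂] at e₃
    rw [e₄, e₅, mul_mul_mul_comm, ← e₃]
    congr 1
    ext; simp; tauto

/-- A planar Brownian motion started at `0`, given by its two coordinates, all of whose paths are
continuous. -/
structure IsContBrownian {Ω : Type*} [MeasurableSpace Ω] (W : ℝ≥0 → Ω → ℝ × ℝ)
    (P : Measure Ω) : Prop where
  measurable : ∀ t, Measurable (W t)
  continuous : ∀ ω, Continuous (W · ω)
  zero : ∀ ω, W 0 ω = 0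
  fst : IsPreBrownianReal (fun t ω ↦ (W t ω).1) P
  snd : IsPreBrownianReal (fun t ω ↦ (W t ω).2) P
  indep : IndepFun (fun ω t ↦ (W t ω).1) (fun ω t ↦ (W t ω).2) P

/-- The path of `W` after time `T`, translated to start at the origin. -/
def after {Ω E : Type*} [Sub E] (W : ℝ≥0 → Ω → E) (T : Ω → ℝ≥0) (t : ℝ≥0) (ω : Ω) : E :=
  W (T ω + t) ω - W (T ω) ω

/-- The events determined by the process up to time `s`. -/
@[reducible] def past {Ω E : Type*} [MeasurableSpace E] (W : ℝ≥0 → Ω → E) (s : ℝ≥0) : MeasurableSpace Ω :=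
  MeasurableSpace.comap (fun ω (t : Set.Iic s) ↦ W t ω) inferInstance

theorem measurable_past {Ω E : Type*} [MeasurableSpace E] (W : ℝ≥0 → Ω → E) {s t : ℝ≥0}
    (h : t ≤ s) : Measurable[past W s] (W t) :=
  (measurable_pi_apply (⟨t, h⟩ : Set.Iic s)).comp
    (comap_measurable fun ω (t : Set.Iic s) ↦ W t ω)

theorem past_mono {Ω E : Type*} [MeasurableSpace E] (W : ℝ≥0 → Ω → E) : Monotone (past W) := by
  intro s t h
  refine (@measurable_pi_lambda _ _ _ (past W t) _ _ fun u ↦ ?_).comap_le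
  exact measurable_past W (u.2.out.trans h)

theorem past_le {Ω E : Type*} [MeasurableSpace Ω] [MeasurableSpace E] {W : ℝ≥0 → Ω → E}
    (hW : ∀ t, Measurable (W t)) (s : ℝ≥0) : past W s ≤ ‹MeasurableSpace Ω› :=
  Measurable.comap_le (measurable_pi_lambda _ fun _ ↦ hW _)

namespace IsContBrownian

variable {Ω : Type*} [MeasurableSpace Ω] {W : ℝ≥0 → Ω → ℝ × ℝ} {P : Measure Ω}

theorem isProbabilityMeasure (hW : IsContBrownian W P) : IsProbabilityMeasure P :=
  hW.fst.isGaussianProcess.isProbabilityMeasure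

theorem indepFun_after (hW : IsContBrownian W P) (s : ℝ≥0) :
    IndepFun (fun ω t ↦ after W (fun _ ↦ s) t ω) (fun ω (t : Set.Iic s) ↦ W t ω) P := by
  have := hW.isProbabilityMeasure
  have m1 (t : ℝ≥0) : Measurable fun ω ↦ (W t ω).1 := (hW.measurable t).fst
  have m2 (t : ℝ≥0) : Measurable fun ω ↦ (W t ω).2 := (hW.measurable t).snd
  let g : (ℝ≥0 → ℝ) → (ℝ≥0 → ℝ) × (Set.Iic s → ℝ) :=
    fun w ↦ (fun t ↦ w (s + t) - w s, fun t ↦ w t)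
  have hg : Measurable g := by fun_prop
  -- Each coordinate has its future independent of its past, and the coordinates are independent;
  -- regrouping gives joint future against joint past.
  have key := indepFun_prodMk_prodMk_of_indepFun (by fun_prop) (by fun_prop) (by fun_prop)
    (by fun_prop) (hW.fst.indepFun_shift s) (hW.snd.indepFun_shift s) (hW.indep.comp hg hg)
  let φ {ι : Type} (w : (ι → ℝ) × (ι → ℝ)) (i : ι) : ℝ × ℝ := (w.1 i, w.2 i)
  have hφ {ι : Type} : Measurable (φ (ι := ι)) := by fun_prop
  exact key.comp hφ hφ

theorem indep_past (hW : IsContBrownian W P) (s : ℝ≥0) :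
    Indep (MeasurableSpace.comap (fun ω t ↦ after W (fun _ ↦ s) t ω) inferInstance)
      (past W s) P :=
  (IndepFun_iff_Indep _ _ _).1 (hW.indepFun_after s)

end IsContBrownian

theorem map_eq_of_isPreBrownianReal {Ω Ω' : Type*} [MeasurableSpace Ω] [MeasurableSpace Ω']
    {P : Measure Ω} {P' : Measure Ω'}
    {X : ℝ≥0 → Ω → ℝ} {X' : ℝ≥0 → Ω' → ℝ} (hX : IsPreBrownianReal X P)
    (hX' : IsPreBrownianReal X' P')
    (mX : ∀ t, Measurable (X t)) (mX' : ∀ t, Measurable (X' t)) :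
    P.map (fun ω t ↦ X t ω) = P'.map (fun ω t ↦ X' t ω) := by
  have := hX.isGaussianProcess.isProbabilityMeasure
  have := hX'.isGaussianProcess.isProbabilityMeasure
  have h1 := isProjectiveLimit_map (P := P) (X := X) (measurable_pi_lambda _ mX).aemeasurable
  have h2 := isProjectiveLimit_map (P := P') (X := X') (measurable_pi_lambda _ mX').aemeasurable
  simp_rw [fun I ↦ (hX.hasLaw I).map_eq] at h1
  simp_rw [fun I ↦ (hX'.hasLaw I).map_eq] at h2
  exact h1.unique h2

namespace IsContBrownian

variable {Ω : Type*} [MeasurableSpace Ω] {W : ℝ≥0 → Ω → ℝ × ℝ} {P : Measure Ω}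

theorem shift (hW : IsContBrownian W P) (s : ℝ≥0) :
    IsContBrownian (after W fun _ ↦ s) P where
  measurable t := (hW.measurable _).sub (hW.measurable _)
  continuous ω := ((hW.continuous ω).comp (by fun_prop)).sub continuous_const
  zero ω := by simp [after]
  fst := hW.fst.shift s
  snd := hW.snd.shift s
  indep := by
    let g : (ℝ≥0 → ℝ) → (ℝ≥0 → ℝ) := fun w t ↦ w (s + t) - w s
    have hg : Measurable g := by fun_prop
    exact hW.indep.comp hg hg

theorem map_pair_eq {Ω' : Type*} [MeasurableSpace Ω'] {W' : ℝ≥0 → Ω' → ℝ × ℝ} {P' : Measure Ω'}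
    (hW : IsContBrownian W P) (hW' : IsContBrownian W' P') :
    P.map (fun ω t ↦ W t ω) = P'.map (fun ω t ↦ W' t ω) := by
  have := hW.isProbabilityMeasure
  have := hW'.isProbabilityMeasure
  have m1 (t : ℝ≥0) : Measurable fun ω ↦ (W t ω).1 := (hW.measurable t).fst
  have m2 (t : ℝ≥0) : Measurable fun ω ↦ (W t ω).2 := (hW.measurable t).snd
  have m1' (t : ℝ≥0) : Measurable fun ω ↦ (W' t ω).1 := (hW'.measurable t).fst
  have m2' (t : ℝ≥0) : Measurable fun ω ↦ (W' t ω).2 := (hW'.measurable t).snd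
  have e := (indepFun_iff_map_prod_eq_prod_map_map
    (Measurable.aemeasurable (by fun_prop)) (Measurable.aemeasurable (by fun_prop))).1 hW.indep
  have e' := (indepFun_iff_map_prod_eq_prod_map_map
    (Measurable.aemeasurable (by fun_prop)) (Measurable.aemeasurable (by fun_prop))).1 hW'.indep
  rw [map_eq_of_isPreBrownianReal hW.fst hW'.fst m1 m1',
    map_eq_of_isPreBrownianReal hW.snd hW'.snd m2 m2', ← e'] at e
  let φ (w : (ℝ≥0 → ℝ) × (ℝ≥0 → ℝ)) (i : ℝ≥0) : ℝ × ℝ := (w.1 i, w.2 i)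
  have hφ : Measurable φ := by fun_prop
  have := congrArg (Measure.map φ) e
  rwa [Measure.map_map hφ (by fun_prop), Measure.map_map hφ (by fun_prop)] at this

theorem of_map_eq {Ω' : Type*} [MeasurableSpace Ω'] {W' : ℝ≥0 → Ω' → ℝ × ℝ} {P' : Measure Ω'}
    [IsProbabilityMeasure P'] (hW : IsContBrownian W P) (hm : ∀ t, Measurable (W' t))
    (hc : ∀ ω, Continuous (W' · ω)) (h0 : ∀ ω, W' 0 ω = 0)
    (h : P'.map (fun ω t ↦ W' t ω) = P.map (fun ω t ↦ W t ω)) :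
    IsContBrownian W' P' := by
  have := hW.isProbabilityMeasure
  have m := hW.measurable
  have tr {E : Type} [MeasurableSpace E] {φ : (ℝ≥0 → ℝ × ℝ) → E} (hφ : Measurable φ) :
      P'.map (fun ω ↦ φ fun t ↦ W' t ω) = P.map (fun ω ↦ φ fun t ↦ W t ω) := by
    have := congrArg (Measure.map φ) h
    rwa [Measure.map_map hφ (by fun_prop), Measure.map_map hφ (by fun_prop)] at this
  have h1 := tr (φ := fun w t ↦ (w t).1) (by fun_prop)
  have h2 := tr (φ := fun w t ↦ (w t).2) (by fun_prop)
  refine ⟨hm, hc, h0,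
    ⟨fun I ↦ ⟨Measurable.aemeasurable (by unfold Finset.restrict; fun_prop), ?_⟩⟩,
    ⟨fun I ↦ ⟨Measurable.aemeasurable (by unfold Finset.restrict; fun_prop), ?_⟩⟩, ?_⟩
  · rw [← (hW.fst.hasLaw I).map_eq]
    exact tr (φ := fun w (t : I) ↦ (w t).1) (by fun_prop)
  · rw [← (hW.snd.hasLaw I).map_eq]
    exact tr (φ := fun w (t : I) ↦ (w t).2) (by fun_prop)
  · rw [indepFun_iff_map_prod_eq_prod_map_map
    (Measurable.aemeasurable (by fun_prop)) (Measurable.aemeasurable (by fun_prop)), h1, h2,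
      ← (indepFun_iff_map_prod_eq_prod_map_map
    (Measurable.aemeasurable (by fun_prop)) (Measurable.aemeasurable (by fun_prop))).1 hW.indep]
    exact tr (φ := fun w ↦ ((fun t ↦ (w t).1), fun t ↦ (w t).2)) (by fun_prop)

end IsContBrownian
-- The strong Markov property
/-- The point of the grid of mesh `1 / (N + 1)` that follows `t`. -/
noncomputable def gridCeil (N : ℕ) (t : ℝ≥0) : ℝ≥0 := (⌈t * (N + 1)⌉₊ : ℝ≥0) / (N + 1)

theorem le_gridCeil (N : ℕ) (t : ℝ≥0) : t ≤ gridCeil N t := by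
  rw [gridCeil, le_div_iff₀ (by positivity)]
  exact Nat.le_ceil _

theorem gridCeil_le (N : ℕ) (t : ℝ≥0) : gridCeil N t ≤ t + 1 / (N + 1) := by
  rw [gridCeil, div_le_iff₀ (by positivity), add_mul, div_mul_cancel₀ _ (by positivity)]
  exact (Nat.ceil_lt_add_one (zero_le)).le

theorem tendsto_gridCeil (t : ℝ≥0) : Tendsto (fun N ↦ gridCeil N t) atTop (𝓝 t) := by
  refine tendsto_of_tendsto_of_tendsto_of_le_of_le tendsto_const_nhds ?_
    (fun N ↦ le_gridCeil N t) (fun N ↦ gridCeil_le N t)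
  simpa using tendsto_const_nhds.add (tendsto_one_div_add_atTop_nhds_zero_nat (𝕜 := ℝ≥0))

theorem measurable_gridCeil (N : ℕ) : Measurable (gridCeil N) := by
  unfold gridCeil
  exact (measurable_from_nat.comp (Nat.measurable_ceil.comp (by fun_prop))).div_const _

/-- A difference of events `T ≤ i / (N + 1)` with `i ≤ j`, all known at time `j / (N + 1)`. -/
theorem measurableSet_past_ceil_eq {Ω E : Type*} [MeasurableSpace E] {W : ℝ≥0 → Ω → E}
    {T : Ω → ℝ≥0} {F : Set Ω}
    (hF : ∀ s, MeasurableSet[past W s] (F ∩ {ω | T ω ≤ s})) (N j : ℕ) :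
    MeasurableSet[past W ((j : ℝ≥0) / (N + 1))] (F ∩ {ω | ⌈T ω * (N + 1)⌉₊ = j}) := by
  have : F ∩ {ω | ⌈T ω * (N + 1)⌉₊ = j} = (F ∩ {ω | T ω ≤ (j : ℝ≥0) / (N + 1)}) \
      ⋃ i ∈ Finset.range j, (F ∩ {ω | T ω ≤ (i : ℝ≥0) / (N + 1)}) := by
    ext ω
    simp only [Set.mem_inter_iff, Set.mem_ofPred_eq, Set.mem_sdiff, Set.mem_iUnion, not_exists,
      Finset.mem_range, le_div_iff₀ (show (0 : ℝ≥0) < N + 1 by positivity), ← Nat.ceil_le]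
    constructor
    · rintro ⟨h, rfl⟩
      exact ⟨⟨h, le_rfl⟩, fun i hi h' ↦ absurd h'.2 (by lia)⟩
    · rintro ⟨⟨h, h'⟩, h''⟩
      exact ⟨h, h'.antisymm (not_lt.1 fun hlt ↦ h'' _ hlt ⟨h, le_rfl⟩)⟩
  rw [this]
  refine MeasurableSet.diff (hF _) (Finset.measurableSet_biUnion _ fun i hi ↦ ?_)
  refine past_mono W ?_ _ (hF _)
  have := (Finset.mem_range.1 hi).le
  gcongr

variable {Ω : Type*} [MeasurableSpace Ω] {W : ℝ≥0 → Ω → ℝ × ℝ} {P : Measure Ω}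

namespace IsContBrownian

theorem setLIntegral_after_const (hW : IsContBrownian W P) {g : (ℝ≥0 → ℝ × ℝ) → ℝ≥0∞}
    (hg : Measurable g) {s : ℝ≥0} {A : Set Ω} (hA : MeasurableSet[past W s] A) :
    ∫⁻ ω in A, g (fun t ↦ after W (fun _ ↦ s) t ω) ∂P = P A * ∫⁻ ω, g (fun t ↦ W t ω) ∂P := by
  have m := hW.measurable
  have m' := (hW.shift s).measurable
  have hA' := past_le m s _ hA
  have e : ∫⁻ ω, g (fun t ↦ after W (fun _ ↦ s) t ω) ∂P = ∫⁻ ω, g (fun t ↦ W t ω) ∂P := by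
    rw [← lintegral_map (g := fun ω t ↦ after W (fun _ ↦ s) t ω) hg (by fun_prop),
      (hW.shift s).map_pair_eq hW, lintegral_map hg (by fun_prop)]
  have key := lintegral_mul_eq_lintegral_mul_lintegral_of_independent_measurableSpace
    (f := fun ω ↦ g (fun t ↦ after W (fun _ ↦ s) t ω)) (g := A.indicator 1)
    (Measurable.comap_le (by fun_prop)) (past_le m s) (hW.indep_past s)
    (hg.comp (comap_measurable _)) ((@measurable_one _ _ _ (past W s) _).indicator hA)
  rw [← lintegral_indicator hA', ← e, mul_comm, ← lintegral_indicator_one hA', ← key]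
  congr with ω
  by_cases h : ω ∈ A <;> simp [h]

/-- The rounded time takes countably many values; on each piece it is constant and the Markov
property at a fixed time applies. -/
theorem setLIntegral_after_gridCeil (hW : IsContBrownian W P) {g : (ℝ≥0 → ℝ × ℝ) → ℝ≥0∞}
    (hg : Measurable g) {T : Ω → ℝ≥0} {F : Set Ω}
    (hF : ∀ s, MeasurableSet[past W s] (F ∩ {ω | T ω ≤ s})) (N : ℕ) :
    ∫⁻ ω in F, g (fun t ↦ after W (fun ω ↦ gridCeil N (T ω)) t ω) ∂P =
      P F * ∫⁻ ω, g (fun t ↦ W t ω) ∂P := by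
  have hm (j : ℕ) := past_le hW.measurable _ _ (measurableSet_past_ceil_eq hF N j)
  have hU : F = ⋃ j : ℕ, F ∩ {ω | ⌈T ω * (N + 1)⌉₊ = j} := by ext; simp
  have hd : Pairwise (Function.onFun Disjoint fun j : ℕ ↦ F ∩ {ω | ⌈T ω * (N + 1)⌉₊ = j}) := by
    refine fun i j hij ↦ Set.disjoint_left.2 ?_
    rintro ω ⟨-, h⟩ ⟨-, h'⟩
    exact hij (h.symm.trans h')
  conv_lhs => rw [hU]
  conv_rhs => rw [hU]
  rw [lintegral_iUnion hm hd, measure_iUnion hd hm, ← ENNReal.tsum_mul_right]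
  congr with j
  rw [← hW.setLIntegral_after_const hg (measurableSet_past_ceil_eq hF N j)]
  refine setLIntegral_congr_fun (hm j) ?_
  rintro ω ⟨-, h⟩
  simp only [Set.mem_ofPred_eq] at h
  simp only [after, gridCeil, h]

theorem measurable_eval (hW : IsContBrownian W P) {T : Ω → ℝ≥0} (hT : Measurable T) :
    Measurable fun ω ↦ W (T ω) ω :=
  (measurable_uncurry_of_continuous_of_measurable hW.continuous hW.measurable).comp
    (hT.prodMk measurable_id)

theorem measurable_after (hW : IsContBrownian W P) {T : Ω → ℝ≥0} (hT : Measurable T) (t : ℝ≥0) :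
    Measurable (after W T t) :=
  (hW.measurable_eval (hT.add_const t)).sub (hW.measurable_eval hT)

theorem measurableSet_of_past (hW : IsContBrownian W P) {T : Ω → ℝ≥0} {F : Set Ω}
    (hF : ∀ s, MeasurableSet[past W s] (F ∩ {ω | T ω ≤ s})) : MeasurableSet F := by
  have : F = ⋃ n : ℕ, F ∩ {ω | T ω ≤ n} := by
    ext ω
    simpa using fun _ ↦ exists_nat_ge (T ω)
  rw [this]
  exact .iUnion fun n ↦ past_le hW.measurable _ _ (hF n)

/-- **Strong Markov property**: conditionally on an event of the past of the stopping time `T`, the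
process after time `T` is a Brownian motion. -/
theorem after_cond (hW : IsContBrownian W P) {T : Ω → ℝ≥0} (hT : Measurable T) {F : Set Ω}
    (hF : ∀ s, MeasurableSet[past W s] (F ∩ {ω | T ω ≤ s})) (hPF : P F ≠ 0) :
    IsContBrownian (after W T) P[|F] := by
  have := hW.isProbabilityMeasure
  have hFm := hW.measurableSet_of_past hF
  have := cond_isProbabilityMeasure hPF
  have m := hW.measurable
  have m' := hW.measurable_after hT
  have m'' (N : ℕ) := hW.measurable_after ((measurable_gridCeil N).comp hT)
  refine hW.of_map_eq m' (fun ω ↦ ?_) (fun ω ↦ by simp [after]) ?_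
  · exact ((hW.continuous ω).comp (by fun_prop)).sub continuous_const
  refine IsProjectiveLimit.unique (P := fun I : Finset ℝ≥0 ↦ P.map (fun ω ↦ I.restrict (W · ω)))
    (fun I ↦ ?_) (isProjectiveLimit_map (measurable_pi_lambda _ m).aemeasurable)
  let φ (w : ℝ≥0 → ℝ × ℝ) (t : I) : ℝ × ℝ := w t
  have hφ : Measurable φ := by fun_prop
  have mW : Measurable fun ω ↦ φ (W · ω) := by fun_prop
  have mA {T : Ω → ℝ≥0} (h : ∀ t, Measurable (after W T t)) :
      Measurable fun ω ↦ φ (after W T · ω) := by fun_prop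
  rw [Measure.map_map (Finset.measurable_restrict _) (by fun_prop)]
  change P[|F].map (fun ω ↦ φ (after W T · ω)) = P.map (fun ω ↦ φ (W · ω))
  -- Bounded continuous test functions and continuous paths allow the limit from the grid times to
  -- `T`.
  refine ext_of_forall_lintegral_eq_of_IsFiniteMeasure fun f ↦ ?_
  have hf : Measurable fun x ↦ (f x : ℝ≥0∞) := f.continuous.measurable.coe_nnreal_ennreal
  rw [lintegral_map hf (mA m'), lintegral_map hf mW, ProbabilityTheory.cond,
    lintegral_smul_measure, smul_eq_mul]
  have key (N : ℕ) := hW.setLIntegral_after_gridCeil (hf.comp hφ) hF N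
  have lim : Tendsto (fun N ↦ ∫⁻ ω in F, (f (φ (after W (fun ω ↦ gridCeil N (T ω)) · ω)) : ℝ≥0∞) ∂P)
      atTop (𝓝 (∫⁻ ω in F, (f (φ (after W T · ω)) : ℝ≥0∞) ∂P)) := by
    refine tendsto_lintegral_of_dominated_convergence (fun _ ↦ (nndist f 0 : ℝ≥0∞))
      (fun N ↦ hf.comp (mA (m'' N))) (fun N ↦ .of_forall fun ω ↦ ?_) ?_ (.of_forall fun ω ↦ ?_)
    · exact ENNReal.coe_le_coe.2 (BoundedContinuousFunction.NNReal.upper_bound f _)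
    · simp [ENNReal.mul_eq_top]
    · refine ENNReal.tendsto_coe.2 ((f.continuous.tendsto _).comp (tendsto_pi_nhds.2 fun t ↦ ?_))
      have hc := tendsto_gridCeil (T ω)
      exact (((hW.continuous ω).tendsto _).comp (hc.add_const _)).sub
        (((hW.continuous ω).tendsto _).comp hc)
  have e := tendsto_nhds_unique lim (tendsto_const_nhds.congr fun N ↦ (key N).symm)
  rw [e, ← mul_assoc, ENNReal.inv_mul_cancel hPF (measure_ne_top _ _), one_mul]
  rfl

end IsContBrownian
-- A maximal inequality
theorem measure_le_of_eventually_mem {Ω : Type*} [MeasurableSpace Ω] {P : Measure Ω} {A : Set Ω}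
    {E : ℕ → Set Ω} {c : ℝ≥0∞} (hA : ∀ ω ∈ A, ∀ᶠ N in atTop, ω ∈ E N) (hE : ∀ N, P (E N) ≤ c) :
    P A ≤ c := by
  have hsub : A ⊆ ⋃ M, ⋂ N ≥ M, E N := fun ω hω ↦ by
    simpa [eventually_atTop] using hA ω hω
  refine (measure_mono hsub).trans ?_
  rw [Monotone.measure_iUnion]
  · exact iSup_le fun M ↦ (measure_mono (Set.biInter_subset_of_mem le_rfl)).trans (hE M)
  · exact fun M M' h ↦ Set.biInter_mono (fun N hN ↦ h.trans hN) fun _ _ ↦ subset_rfl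

theorem half_le_gaussianReal_Ici (v : ℝ≥0) : 1 / 2 ≤ gaussianReal 0 v (Set.Ici 0) := by
  have h1 : gaussianReal 0 v (Set.Iic 0) = gaussianReal 0 v (Set.Ici 0) := by
    conv_rhs => rw [← neg_zero, ← gaussianReal_map_neg]
    rw [Measure.map_apply (by fun_prop) (by measurability)]
    congr 1; ext; simp
  have h2 : 1 ≤ gaussianReal 0 v (Set.Iic 0) + gaussianReal 0 v (Set.Ici 0) := by
    rw [← measure_univ (μ := gaussianReal 0 v), ← Set.Iic_union_Ici (a := (0 : ℝ))]
    exact measure_union_le _ _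
  rw [h1, ← two_mul] at h2
  exact ENNReal.div_le_of_le_mul' h2

section Levy

variable {Ω : Type*} [MeasurableSpace Ω] {X : ℝ≥0 → Ω → ℝ} {P : Measure Ω}

/-- Decompose by the first index at which the level is reached: the increment from there to `u n` is
independent of the past and nonnegative with probability at least 1/2. -/
theorem measure_exists_le_of_monotone (hX : IsPreBrownianReal X P) (mX : ∀ t, Measurable (X t))
    {u : ℕ → ℝ≥0} (hu : Monotone u) (n : ℕ) {a : ℝ} :
    P {ω | ∃ j ≤ n, a ≤ X (u j) ω} ≤ 2 * P {ω | a ≤ X (u n) ω} := by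
  let B (j : ℕ) : Set Ω := {ω | a ≤ X (u j) ω}
  have mB {i j : ℕ} (h : i ≤ j) : MeasurableSet[past X (u j)] (B i) :=
    measurable_past X (hu h) measurableSet_Ici
  have hd (j : ℕ) : disjointed B j = B j \ ⋃ i ∈ Finset.range j, B i := by
    rw [disjointed_apply, Finset.sup_set_eq_biUnion]
    congr; ext; simp
  have mA (j : ℕ) : MeasurableSet[past X (u j)] (disjointed B j) := by
    rw [hd]
    refine MeasurableSet.diff (mB le_rfl) (Finset.measurableSet_biUnion _ fun i hi ↦ ?_)
    exact mB (Finset.mem_range.1 hi).le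
  have mA' (j : ℕ) := past_le mX _ _ (mA j)
  have step (j : ℕ) (hj : j ≤ n) : P (disjointed B j) ≤ 2 * P (disjointed B j ∩ B n) := by
    have hind := (IndepFun_iff_Indep _ _ _).1 (hX.indepFun_shift (u j))
    have e := (Indep_iff _ _ _).1 hind _ (disjointed B j)
      ⟨{w | 0 ≤ w (u n - u j)}, measurableSet_le (by fun_prop) (by fun_prop), rfl⟩ (mA j)
    have hlaw := ((hX.shift (u j)).hasLaw_eval (u n - u j))
    have hm := half_le_gaussianReal_Ici (u n - u j)
    rw [← hlaw.map_eq, Measure.map_apply_of_aemeasurable hlaw.aemeasurable measurableSet_Ici] at hm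
    calc P (disjointed B j) = 2 * (1 / 2 * P (disjointed B j)) := by
          rw [← mul_assoc, ENNReal.mul_div_cancel (by simp) (by simp), one_mul]
      _ ≤ 2 * (P _ * P (disjointed B j)) := by gcongr
      _ ≤ 2 * P (disjointed B j ∩ B n) := by
          refine mul_le_mul_right (e.symm.trans_le (measure_mono ?_)) _
          rintro ω ⟨h, h'⟩
          refine ⟨h', ?_⟩
          have h1 : a ≤ X (u j) ω := disjointed_subset B j h'
          have h2 : 0 ≤ X (u j + (u n - u j)) ω - X (u j) ω := h
          rw [add_tsub_cancel_of_le (hu hj)] at h2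
          exact h1.trans (sub_nonneg.1 h2)
  have hU : {ω | ∃ j ≤ n, a ≤ X (u j) ω} ⊆ ⋃ j ∈ Finset.range (n + 1), disjointed B j := by
    rintro ω ⟨j, hj, h⟩
    have : ω ∈ ⋃ j, disjointed B j := iUnion_disjointed (f := B) ▸ Set.mem_iUnion.2 ⟨j, h⟩
    obtain ⟨i, hi⟩ := Set.mem_iUnion.1 this
    refine Set.mem_biUnion (Finset.mem_coe.2 (Finset.mem_range.2 ?_)) hi
    by_contra! hlt
    rw [hd] at hi
    exact hi.2 (Set.mem_biUnion (x := j) (Finset.mem_coe.2 (Finset.mem_range.2 (by lia))) h)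
  calc _ ≤ P (⋃ j ∈ Finset.range (n + 1), disjointed B j) := measure_mono hU
    _ ≤ ∑ j ∈ Finset.range (n + 1), P (disjointed B j) := measure_biUnion_finset_le _ _
    _ ≤ ∑ j ∈ Finset.range (n + 1), 2 * P (disjointed B j ∩ B n) :=
        Finset.sum_le_sum fun j hj ↦ step j (by simpa [Nat.lt_succ_iff] using hj)
    _ = 2 * P (⋃ j ∈ Finset.range (n + 1), (disjointed B j ∩ B n)) := by
        rw [← Finset.mul_sum, measure_biUnion_finset]
        · exact fun i _ j _ hij ↦ ((disjoint_disjointed B hij).mono Set.inter_subset_left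
            Set.inter_subset_left)
        · exact fun j _ ↦ (mA' j).inter (past_le mX _ _ (mB le_rfl))
    _ ≤ 2 * P (B n) := by
        gcongr
        exact Set.iUnion₂_subset fun _ _ ↦ Set.inter_subset_right

theorem measure_le_abs (hX : IsPreBrownianReal X P) (s : ℝ≥0) {a : ℝ} (ha : 0 < a) :
    P {ω | a ≤ |X s ω|} ≤ ENNReal.ofReal (s / a ^ 2) := by
  have := hX.isGaussianProcess.isProbabilityMeasure
  have h := meas_ge_le_variance_div_sq (hX.isGaussianProcess.hasGaussianLaw_eval s).memLp_two ha
  rwa [(hX.hasLaw_eval s).variance_eq, variance_id_gaussianReal, hX.integral_eval,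
    show {ω | a ≤ |X s ω - 0|} = {ω | a ≤ |X s ω|} by simp] at h

/-- A maximal inequality for Brownian motion. -/
theorem measure_exists_le_abs (hX : IsPreBrownianReal X P) (mX : ∀ t, Measurable (X t))
    (cX : ∀ ω, Continuous (X · ω)) {s : ℝ≥0} {a : ℝ} (ha : 0 < a) :
    P {ω | ∃ r ≤ s, a ≤ |X r ω|} ≤ 4 * ENNReal.ofReal (s / (a / 2) ^ 2) := by
  -- Halving the level makes the inequality strict at `r`, so that it persists at nearby grid
  -- points.
  refine measure_le_of_eventually_mem
    (E := fun N ↦ {ω | ∃ j ≤ N + 1, a / 2 ≤ |X ((j : ℝ≥0) / (N + 1) * s) ω|}) ?_ fun N ↦ ?_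
  · rintro ω ⟨r, hr, h⟩
    have lim : Tendsto (fun N ↦ |X (gridCeil N (r / s) * s) ω|) atTop (𝓝 |X r ω|) := by
      have h1 : Tendsto (fun N ↦ gridCeil N (r / s) * s) atTop (𝓝 (r / s * s)) :=
        (tendsto_gridCeil _).mul_const _
      rw [div_mul_cancel_of_imp fun h ↦ by simpa [h] using hr] at h1
      exact (((cX ω).tendsto _).comp h1).abs
    filter_upwards [lim.eventually_const_le (show a / 2 < |X r ω| by linarith)] with N hN
    refine ⟨⌈r / s * (N + 1)⌉₊, Nat.ceil_le.2 ?_, hN⟩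
    push_cast
    exact mul_le_of_le_one_left (by positivity) (div_le_one_of_le₀ hr (by positivity))
  · have hu : Monotone fun j : ℕ ↦ (j : ℝ≥0) / (N + 1) * s := fun i j h ↦ by
      have : (i : ℝ≥0) ≤ j := by exact_mod_cast h
      dsimp only; gcongr
    have h1 := measure_exists_le_of_monotone hX mX hu (N + 1) (a := a / 2)
    have h2 := measure_exists_le_of_monotone hX.neg (fun t ↦ (mX t).neg) hu (N + 1) (a := a / 2)
    have h3 := measure_le_abs hX s (half_pos ha)
    have e : ((N + 1 : ℕ) : ℝ≥0) / (N + 1) * s = s := by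
      push_cast; rw [div_self (by positivity), one_mul]
    rw [e] at h1 h2
    refine (measure_mono (t := {ω | ∃ j ≤ N + 1, a / 2 ≤ X ((j : ℝ≥0) / (N + 1) * s) ω} ∪
      {ω | ∃ j ≤ N + 1, a / 2 ≤ (-X) ((j : ℝ≥0) / (N + 1) * s) ω}) ?_).trans
      ((measure_union_le _ _).trans ((add_le_add h1 h2).trans ?_))
    · rintro ω ⟨j, hj, h⟩
      exact (le_abs.1 h).imp (fun h ↦ ⟨j, hj, h⟩) fun h ↦ ⟨j, hj, h⟩
    · rw [← mul_add, show (4 : ℝ≥0∞) = 2 * 2 by norm_num, mul_assoc]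
      refine mul_le_mul_right ?_ _
      rw [two_mul]
      exact add_le_add ((measure_mono fun ω (h : a / 2 ≤ X s ω) ↦ le_abs.2 (.inl h)).trans h3)
        ((measure_mono fun ω (h : a / 2 ≤ -X s ω) ↦ le_abs.2 (.inr h)).trans h3)

end Levy

/-! ### First exit from an interval -/

/-- The first time at which `f` leaves `(c, d)`. -/
noncomputable def firstExit (c d : ℝ) (f : ℝ≥0 → ℝ) : ℝ≥0 := sInf {r | f r ∉ Set.Ioo c d}

section Path

variable {c d : ℝ} {f : ℝ≥0 → ℝ}

theorem firstExit_le {r : ℝ≥0} (h : f r ∉ Set.Ioo c d) : firstExit c d f ≤ r :=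
  csInf_le (OrderBot.bddBelow _) h

theorem apply_firstExit_notMem (hf : Continuous f) (h : ∃ r, f r ∉ Set.Ioo c d) :
    f (firstExit c d f) ∉ Set.Ioo c d :=
  IsClosed.csInf_mem (isOpen_Ioo.isClosed_compl.preimage hf) h (OrderBot.bddBelow _)

theorem apply_firstExit (hf : Continuous f) (h0 : f 0 ∈ Set.Ioo c d)
    (h : ∃ r, f r ∉ Set.Ioo c d) : f (firstExit c d f) = c ∨ f (firstExit c d f) = d := by
  have hT := apply_firstExit_notMem hf h
  set T := firstExit c d f with hTdef
  have ivt {e : ℝ} (he : e ∉ Set.Ioo c d) (he' : e ∈ Set.uIcc (f 0) (f T)) : f T = e := by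
    obtain ⟨r, hr, rfl⟩ := intermediate_value_uIcc hf.continuousOn he'
    rw [Set.uIcc_of_le zero_le] at hr
    rw [hr.2.antisymm (firstExit_le he)]
  by_cases hc : f T ≤ c
  · exact .inl (ivt (by simp) (Set.mem_uIcc.2 (.inr ⟨hc, h0.1.le⟩)))
  · refine .inr (ivt (by simp) (Set.mem_uIcc.2 (.inl ⟨h0.2.le, ?_⟩)))
    by_contra! hd
    exact hT ⟨not_le.1 hc, hd⟩

theorem firstExit_stopped {s : ℝ≥0} (hf : Continuous f)
    (h : ∃ r ≤ s, f r ∉ Set.Ioo c d) :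
    firstExit c d (fun r ↦ f (min r s)) = firstExit c d f := by
  obtain ⟨r, hr, h⟩ := h
  have hT := apply_firstExit_notMem hf ⟨r, h⟩
  refine le_antisymm (firstExit_le ?_) (le_csInf ⟨r, ?_⟩ fun u hu ↦ ?_)
  · rwa [min_eq_left ((firstExit_le h).trans hr)]
  · simpa [min_eq_left hr] using h
  · exact (firstExit_le hu).trans (min_le_left _ _)

end Path

/-- By compactness a path inside the open interval keeps a distance `1 / (k + 1)` from its ends, a
closed condition that can be tested on a countable dense set of times. -/
theorem measurableSet_forall_mem_Ioo {Ω : Type*} {m : MeasurableSpace Ω} {V : ℝ≥0 → Ω → ℝ}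
    (hc : ∀ ω, Continuous (V · ω)) {s : ℝ≥0} (hm : ∀ r ≤ s, Measurable (V r)) (c d : ℝ) :
    MeasurableSet {ω | ∀ r ≤ s, V r ω ∈ Set.Ioo c d} := by
  let u : unitInterval → ℝ≥0 := fun r ↦ s * unitInterval.toNNReal r
  have hu : Continuous u := by fun_prop
  have hus (r) : u r ≤ s := mul_le_of_le_one_right zero_le (Subtype.coe_le_coe.1 r.2.2)
  have : {ω | ∀ r ≤ s, V r ω ∈ Set.Ioo c d} = ⋃ k : ℕ, ⋂ i : ℕ,
      {ω | V (u (TopologicalSpace.denseSeq unitInterval i)) ω ∈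
        Set.Icc (c + 1 / (k + 1)) (d - 1 / (k + 1))} := by
    ext ω
    simp only [Set.mem_ofPred_eq, Set.mem_iUnion, Set.mem_iInter]
    constructor
    · intro h
      have hg : Continuous fun r ↦ min (V (u r) ω - c) (d - V (u r) ω) := by
        have := (hc ω).comp hu
        simp only [Function.comp_def] at this
        fun_prop
      obtain ⟨r₀, -, hr₀⟩ := isCompact_univ.exists_isMinOn Set.univ_nonempty hg.continuousOn
      have hpos : 0 < min (V (u r₀) ω - c) (d - V (u r₀) ω) :=
        lt_min (sub_pos.2 (h _ (hus _)).1) (sub_pos.2 (h _ (hus _)).2)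
      obtain ⟨k, hk⟩ := exists_nat_one_div_lt hpos
      refine ⟨k, fun i ↦ ?_⟩
      have := hk.le.trans (hr₀ (Set.mem_univ (TopologicalSpace.denseSeq unitInterval i)))
      rw [le_min_iff] at this
      constructor <;> linarith
    · rintro ⟨k, hk⟩ r hr
      have hcl : IsClosed {v | V (u v) ω ∈ Set.Icc (c + 1 / (k + 1 : ℝ)) (d - 1 / (k + 1))} :=
        isClosed_Icc.preimage ((hc ω).comp hu)
      have hall : ∀ v, V (u v) ω ∈ Set.Icc (c + 1 / (k + 1 : ℝ)) (d - 1 / (k + 1)) := fun v ↦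
        (TopologicalSpace.denseRange_denseSeq unitInterval).induction_on
          (p := fun v ↦ V (u v) ω ∈ Set.Icc (c + 1 / (k + 1 : ℝ)) (d - 1 / (k + 1))) v hcl hk
      have hpos : (0 : ℝ) < 1 / (k + 1) := by positivity
      have hv : u ⟨(r / s : ℝ≥0), by positivity, by exact_mod_cast div_le_one_of_le₀ hr zero_le⟩ = r :=
        mul_div_cancel_of_imp' fun h ↦ by simpa [h] using hr
      have := hall ⟨(r / s : ℝ≥0), by positivity, by exact_mod_cast div_le_one_of_le₀ hr zero_le⟩
      rw [hv] at this
      exact ⟨by linarith [this.1], by linarith [this.2]⟩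
  rw [this]
  exact .iUnion fun k ↦ .iInter fun i ↦ hm _ (hus _) measurableSet_Icc

theorem measurableSet_exists_notMem_Ioo {Ω : Type*} {m : MeasurableSpace Ω} {V : ℝ≥0 → Ω → ℝ}
    (hc : ∀ ω, Continuous (V · ω)) (hm : ∀ r, Measurable (V r)) (c d : ℝ) :
    MeasurableSet {ω | ∃ r, V r ω ∉ Set.Ioo c d} := by
  have : {ω | ∃ r, V r ω ∉ Set.Ioo c d} = ⋃ n : ℕ, {ω | ∀ r ≤ (n : ℝ≥0), V r ω ∈ Set.Ioo c d}ᶜ := by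
    ext ω
    simp only [Set.mem_ofPred_eq, Set.mem_iUnion, Set.mem_compl_iff, not_forall, exists_prop]
    exact ⟨fun ⟨r, h⟩ ↦ (exists_nat_ge r).imp fun n hn ↦ ⟨r, hn, h⟩, fun ⟨n, r, hn, h⟩ ↦ ⟨r, h⟩⟩
  rw [this]
  exact .iUnion fun n ↦ (measurableSet_forall_mem_Ioo hc (fun r _ ↦ hm r) c d).compl

theorem measurable_firstExit {Ω : Type*} {m : MeasurableSpace Ω} {V : ℝ≥0 → Ω → ℝ}
    (hc : ∀ ω, Continuous (V · ω)) (hm : ∀ r, Measurable (V r)) (c d : ℝ) :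
    Measurable fun ω ↦ firstExit c d (V · ω) := by
  refine measurable_of_Iic fun s ↦ ?_
  have : (fun ω ↦ firstExit c d (V · ω)) ⁻¹' Set.Iic s =
      {ω | ∀ r ≤ s, V r ω ∈ Set.Ioo c d}ᶜ ∪ {ω | ∃ r, V r ω ∉ Set.Ioo c d}ᶜ := by
    ext ω
    simp only [Set.mem_preimage, Set.mem_Iic, Set.mem_union, Set.mem_compl_iff, Set.mem_ofPred_eq,
      not_forall, not_exists, not_not, exists_prop]
    constructor
    · intro h
      by_cases hex : ∃ r, V r ω ∉ Set.Ioo c d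
      · exact .inl ⟨_, h, apply_firstExit_notMem (hc ω) hex⟩
      · exact .inr (by simpa using hex)
    · rintro (⟨r, hr, h⟩ | h)
      · exact (firstExit_le h).trans hr
      -- A path that never exits has `firstExit` equal to `sInf ∅ = 0`.
      · have : {r | V r ω ∉ Set.Ioo c d} = ∅ := by ext r; simpa using h r
        rw [firstExit, this, NNReal.sInf_empty]
        exact zero_le
  rw [this]
  exact (measurableSet_forall_mem_Ioo hc (fun r _ ↦ hm r) c d).compl.union
    (measurableSet_exists_notMem_Ioo hc hm c d).compl

/-- An exit by time `s` can be read off the path stopped at `s`. The existence clause excludes the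
default value `0` of a path that never exits. -/
theorem measurableSet_past_firstExit {Ω : Type*} {W : ℝ≥0 → Ω → ℝ × ℝ}
    (hW : ∀ ω, Continuous (W · ω)) (c d : ℝ) {A : Set (ℝ × ℝ)}
    (hA : MeasurableSet A) (s : ℝ≥0) :
    MeasurableSet[past W s] ({ω | (∃ r, (W r ω).1 ∉ Set.Ioo c d) ∧
        W (firstExit c d fun r ↦ (W r ω).1) ω ∈ A} ∩
      {ω | firstExit c d (fun r ↦ (W r ω).1) ≤ s}) := by
  have hc (ω : Ω) : Continuous fun r ↦ (W r ω).1 := (hW ω).fst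
  have : {ω | (∃ r, (W r ω).1 ∉ Set.Ioo c d) ∧ W (firstExit c d fun r ↦ (W r ω).1) ω ∈ A} ∩
      {ω | firstExit c d (fun r ↦ (W r ω).1) ≤ s} =
      {ω | ∀ r ≤ s, (W r ω).1 ∈ Set.Ioo c d}ᶜ ∩
        {ω | W (min (firstExit c d fun r ↦ (W (min r s) ω).1) s) ω ∈ A} := by
    ext ω
    simp only [Set.mem_inter_iff, Set.mem_compl_iff, Set.mem_ofPred_eq, not_forall, exists_prop]
    constructor
    · rintro ⟨⟨hex, h⟩, hs⟩
      have hex' : ∃ r ≤ s, (W r ω).1 ∉ Set.Ioo c d := ⟨_, hs, apply_firstExit_notMem (hc ω) hex⟩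
      refine ⟨hex', ?_⟩
      rwa [firstExit_stopped (f := fun r ↦ (W r ω).1) (hc ω) hex', min_eq_left hs]
    · rintro ⟨hex, h⟩
      have hs : firstExit c d (fun r ↦ (W r ω).1) ≤ s :=
        let ⟨r, hr, h⟩ := hex; (firstExit_le h).trans hr
      rw [firstExit_stopped (f := fun r ↦ (W r ω).1) (hc ω) hex, min_eq_left hs] at h
      exact ⟨⟨hex.imp fun _ h ↦ h.2, h⟩, hs⟩
  rw [this]
  let _ : MeasurableSpace Ω := past W s
  have hm (r : ℝ≥0) : Measurable (W (min r s)) := measurable_past W (min_le_right r s)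
  have hcm (ω : Ω) : Continuous fun r ↦ W (min r s) ω :=
    (hW ω).comp (continuous_id.min continuous_const)
  refine (measurableSet_forall_mem_Ioo hc (fun r hr ↦ (measurable_past W hr).fst) c d).compl.inter ?_
  have hT := measurable_firstExit (fun ω ↦ (hcm ω).fst) (fun r ↦ (hm r).fst) c d
  exact ((measurable_uncurry_of_continuous_of_measurable hcm hm).comp
    (hT.prodMk measurable_id)) hA

/-! ### The second coordinate when the first one exits -/

theorem gaussianReal_Ioo_lt_one (K : ℝ) : gaussianReal 0 1 (Set.Ioo (-K) K) < 1 := by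
  refine lt_of_le_of_ne prob_le_one fun h ↦ ?_
  have h1 : gaussianReal 0 1 (Set.Ioo (-K) K)ᶜ = 0 := (prob_compl_eq_zero_iff measurableSet_Ioo).2 h
  have h2 := gaussianReal_absolutelyContinuous' 0 one_ne_zero
    (measure_mono_null (show Set.Ici K ⊆ (Set.Ioo (-K) K)ᶜ from fun x hx h ↦ hx.out.not_gt h.2) h1)
  simp at h2

/-- A Brownian increment over a time at least `s` lies in `(-a, a)` with probability at most that
of `(-K, K)` under the standard normal law, if `a ≤ K √s`. -/
theorem measure_abs_lt_le {Ω : Type*} [MeasurableSpace Ω] {X : ℝ≥0 → Ω → ℝ} {P : Measure Ω}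
    (hX : IsPreBrownianReal X P) {t : ℝ≥0} (ht : t ≠ 0) {a K : ℝ} (h : a ≤ K * √t) :
    P {ω | |X t ω| < a} ≤ gaussianReal 0 1 (Set.Ioo (-K) K) := by
  have hlaw := hX.hasLaw_eval t
  have e : gaussianReal 0 t = (gaussianReal 0 1).map (√t * ·) := by
    rw [gaussianReal_map_const_mul, mul_zero]
    congr
    ext; simp
  have hset : {ω | |X t ω| < a} = X t ⁻¹' Set.Ioo (-a) a := by ext; simp [abs_lt]
  rw [hset, ← Measure.map_apply_of_aemeasurable hlaw.aemeasurable measurableSet_Ioo, hlaw.map_eq, e,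
    Measure.map_apply (by fun_prop) measurableSet_Ioo]
  have hs : 0 < √(t : ℝ) := Real.sqrt_pos.2 (NNReal.coe_pos.2 (pos_of_ne_zero ht))
  refine measure_mono fun x hx ↦ ?_
  have h1 := abs_lt.2 (Set.mem_preimage.1 hx)
  rw [abs_mul, abs_of_pos hs, mul_comm] at h1
  exact abs_lt.1 (lt_of_mul_lt_mul_right (h1.trans_le h) hs.le)

/-- The events determined by the first coordinate of the process. -/
@[reducible] def sigmaFst {Ω : Type*} (W : ℝ≥0 → Ω → ℝ × ℝ) : MeasurableSpace Ω :=
  MeasurableSpace.comap (fun ω t ↦ (W t ω).1) inferInstance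

namespace IsContBrownian

variable {Ω : Type*} [MeasurableSpace Ω] {W : ℝ≥0 → Ω → ℝ × ℝ} {P : Measure Ω}

/-- The second coordinate is likely to be far from `0` when the first one leaves an interval. -/
theorem measure_firstExit_le (hW : IsContBrownian W P) {c d m K : ℝ} (hm : 0 < m) (hK : 0 ≤ K)
    (hc : m ≤ -c) (hd : m ≤ d) :
    P {ω | (∃ r, (W r ω).1 ∉ Set.Ioo c d) ∧
      |(W (firstExit c d fun r ↦ (W r ω).1) ω).2| < K * m} ≤
      (1 + gaussianReal 0 1 (Set.Ioo (-(6 * K)) (6 * K))) / 2 := by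
  have := hW.isProbabilityMeasure
  set β := gaussianReal 0 1 (Set.Ioo (-(6 * K)) (6 * K)) with hβ
  have hXc (ω : Ω) : Continuous fun r ↦ (W r ω).1 := (hW.continuous ω).fst
  have hXm (t : ℝ≥0) : Measurable fun ω ↦ (W t ω).1 := (hW.measurable t).fst
  have hle : sigmaFst W ≤ ‹MeasurableSpace Ω› := Measurable.comap_le (measurable_pi_lambda _ hXm)
  have hX (t : ℝ≥0) : Measurable[sigmaFst W] fun ω ↦ (W t ω).1 :=
    (measurable_pi_apply t).comp (comap_measurable fun ω (t : ℝ≥0) ↦ (W t ω).1)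
  let T (ω : Ω) : ℝ≥0 := firstExit c d fun r ↦ (W r ω).1
  let H : Set Ω := {ω | ∃ r, (W r ω).1 ∉ Set.Ioo c d}
  have hT : Measurable[sigmaFst W] T := measurable_firstExit hXc hX c d
  have hH : MeasurableSet[sigmaFst W] H := measurableSet_exists_notMem_Ioo hXc hX c d
  -- Small enough for the maximal inequality to give `4 * (1 / 8) = 1 / 2`, and large enough that `m
  -- / 6 ≤ √s`, whence the factor 6.
  let s : ℝ≥0 := ⟨m ^ 2 / 32, by positivity⟩
  have hs : 0 < s := show 0 < m ^ 2 / 32 by positivity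
  refine measure_le_of_eventually_mem (E := fun N ↦ H ∩ {ω | |(W (gridCeil N (T ω)) ω).2| < K * m})
    ?_ fun N ↦ ?_
  · rintro ω ⟨h1, h2⟩
    have lim : Tendsto (fun N ↦ |(W (gridCeil N (T ω)) ω).2|) atTop (𝓝 |(W (T ω) ω).2|) :=
      (((hW.continuous ω).snd.tendsto _).comp (tendsto_gridCeil (T ω))).abs
    filter_upwards [lim.eventually_lt_const h2] with N hN using ⟨h1, hN⟩
  let S : Set Ω := {ω | gridCeil N (T ω) < s}
  have hS : MeasurableSet[sigmaFst W] S := (measurable_gridCeil N).comp hT measurableSet_Iio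
  let D (j : ℕ) : Set Ω := (H \ S) ∩ {ω | ⌈T ω * (N + 1)⌉₊ = j}
  have hD (j : ℕ) : MeasurableSet[sigmaFst W] (D j) :=
    (hH.diff hS).inter (Nat.measurable_ceil.comp (hT.mul_const _) (measurableSet_singleton j))
  -- `D j` depends on the first coordinate only, and on it the height is taken at a fixed time that
  -- is at least `s`.
  have hind (j : ℕ) : P (D j ∩ {ω | |(W ((j : ℝ≥0) / (N + 1)) ω).2| < K * m}) ≤ P (D j) * β := by
    obtain h | ⟨ω, ⟨-, hω⟩, hj⟩ := (D j).eq_empty_or_nonempty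
    · simp [h]
    have hsj : s ≤ (j : ℝ≥0) / (N + 1) := by
      simp only [S, Set.mem_ofPred_eq, not_lt, gridCeil] at hω
      rwa [← hj.out]
    rw [(Indep_iff _ _ _).1 ((IndepFun_iff_Indep _ _ _).1 hW.indep) (D j)
      {ω | |(W ((j : ℝ≥0) / (N + 1)) ω).2| < K * m} (hD j)
      ⟨{w | |w ((j : ℝ≥0) / (N + 1))| < K * m}, measurableSet_lt (by fun_prop) (by fun_prop), rfl⟩]
    refine mul_le_mul_right (measure_abs_lt_le hW.snd (hs.trans_le hsj).ne' ?_) _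
    have h1 : √(m ^ 2 / 32) ≤ √((j : ℝ≥0) / (N + 1) : ℝ≥0) := Real.sqrt_le_sqrt hsj
    have h2 : m / 6 ≤ √(m ^ 2 / 32) := Real.le_sqrt_of_sq_le (by nlinarith)
    nlinarith
  have hsub : H ∩ {ω | |(W (gridCeil N (T ω)) ω).2| < K * m} ⊆ (H ∩ S) ∪
      ⋃ j : ℕ, (D j ∩ {ω | |(W ((j : ℝ≥0) / (N + 1)) ω).2| < K * m}) := by
    rintro ω ⟨h1, h2⟩
    by_cases h : ω ∈ S
    · exact .inl ⟨h1, h⟩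
    · exact .inr (Set.mem_iUnion.2 ⟨_, ⟨⟨h1, h⟩, rfl⟩, h2⟩)
  have hdis : Pairwise (Function.onFun Disjoint D) := fun i j hij ↦ Set.disjoint_left.2
    fun ω h h' ↦ hij (h.2.symm.trans h'.2)
  have hDS : P (⋃ j, D j) ≤ P (H ∩ S)ᶜ :=
    measure_mono (Set.iUnion_subset fun j ω h h' ↦ h.1.2 h'.2)
  have hHS : P (H ∩ S) ≤ 1 / 2 := by
    refine (measure_mono (t := {ω | ∃ r ≤ s, m ≤ |(W r ω).1|}) ?_).trans
      ((measure_exists_le_abs hW.fst hXm hXc hm).trans ?_)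
    · rintro ω ⟨h1, h2⟩
      refine ⟨T ω, (le_gridCeil N _).trans h2.out.le, ?_⟩
      have := apply_firstExit_notMem (hXc ω) h1
      rw [Set.mem_Ioo, not_and_or, not_lt, not_lt] at this
      rw [le_abs]
      exact this.symm.imp (fun h ↦ hd.trans h) fun h ↦ hc.trans (neg_le_neg h)
    · have : (s : ℝ) / (m / 2) ^ 2 = 1 / 8 := by
        change m ^ 2 / 32 / (m / 2) ^ 2 = 1 / 8
        field_simp; norm_num
      rw [this, show (4 : ℝ≥0∞) = ENNReal.ofReal 4 by norm_num,
        ← ENNReal.ofReal_mul (by norm_num), show (4 * (1 / 8) : ℝ) = 1 / 2 by norm_num,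
        ENNReal.ofReal_div_of_pos (by norm_num)]
      simp
  have hβ1 : β ≤ 1 := (gaussianReal_Ioo_lt_one _).le
  calc P (H ∩ {ω | |(W (gridCeil N (T ω)) ω).2| < K * m})
      ≤ P (H ∩ S) + ∑' j, P (D j) * β := (measure_mono hsub).trans
        ((measure_union_le _ _).trans (add_le_add le_rfl
          ((measure_iUnion_le _).trans (ENNReal.tsum_le_tsum hind))))
    _ = P (H ∩ S) + P (⋃ j, D j) * β := by
        rw [ENNReal.tsum_mul_right, measure_iUnion hdis fun j ↦ hle _ (hD j)]
    _ ≤ P (H ∩ S) + (1 - P (H ∩ S)) * β := by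
        rw [← prob_compl_eq_one_sub (hle _ (hH.inter hS))]
        gcongr
    -- As `β ≤ 1`, the bound `p + (1 - p) * β` is nondecreasing in `p`, and `p ≤ 1 / 2`.
    _ ≤ (1 + β) / 2 := by
        have hp : P (H ∩ S) ≠ ⊤ := measure_ne_top _ _
        have hb : β ≠ ⊤ := measure_ne_top _ _
        generalize P (H ∩ S) = p at *
        lift p to ℝ≥0 using hp
        rw [← ENNReal.coe_toNNReal hb] at hβ1 ⊢
        generalize β.toNNReal = b at *
        have hp' : p ≤ 1 / 2 := by
          rw [← ENNReal.coe_le_coe]; simpa using hHS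
        have hb' : b ≤ 1 := by exact_mod_cast hβ1
        rw [show (1 + (b : ℝ≥0∞)) / 2 = ((1 + b) / 2 : ℝ≥0) by simp]
        norm_cast
        have hp1 : p ≤ 1 := hp'.trans (by norm_num)
        rw [← NNReal.coe_le_coe] at hp' hb' ⊢
        push_cast [NNReal.coe_sub hp1] at hp' hb' ⊢
        nlinarith

end IsContBrownian

/-! ### Passages from slit to slit -/

/-- A pair of reals as a complex number. -/
def toC (p : ℝ × ℝ) : ℂ := ⟨p.1, p.2⟩

theorem abs_im_lt_of_mem_domain {x b : ℤ → ℝ} {z : ℂ} (hz : z ∈ domain x b) {n : ℤ}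
    (hn : z.re = x n) : |z.im| < b n := by
  have h : z ∉ slit x b n := fun h ↦ hz (Set.mem_iUnion.2 ⟨n, h⟩)
  simp only [slit, Set.mem_ofPred_eq, hn, true_and, not_or, not_le] at h
  exact abs_lt.2 ⟨h.2, h.1⟩

/-- Strong Markov at the exit, separately for each endpoint. Only the exit events are conditioned
on, so `S₁` and `S₂` may be non-measurable. -/
theorem IsContBrownian.measure_firstExit_split_le {Ω : Type*} [MeasurableSpace Ω]
    {W : ℝ≥0 → Ω → ℝ × ℝ} {P : Measure Ω} (hW : IsContBrownian W P) {c d : ℝ} (hcd : c < d)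
    {B : Set ℝ} (hB : MeasurableSet B) {S₁ S₂ : Set Ω} {q : ℝ≥0∞}
    (hS : ∀ F : Set Ω, IsContBrownian (after W fun ω ↦ firstExit c d fun r ↦ (W r ω).1) P[|F] →
      P[|F] S₁ ≤ q ∧ P[|F] S₂ ≤ q) :
    P {ω | (∃ r, (W r ω).1 ∉ Set.Ioo c d) ∧ (W (firstExit c d fun r ↦ (W r ω).1) ω).2 ∈ B ∧
      (((W (firstExit c d fun r ↦ (W r ω).1) ω).1 = c ∧ ω ∈ S₁) ∨
       ((W (firstExit c d fun r ↦ (W r ω).1) ω).1 = d ∧ ω ∈ S₂))} ≤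
    q * P {ω | (∃ r, (W r ω).1 ∉ Set.Ioo c d) ∧
      (W (firstExit c d fun r ↦ (W r ω).1) ω).2 ∈ B} := by
  have := hW.isProbabilityMeasure
  have hT := measurable_firstExit (fun ω ↦ (hW.continuous ω).fst)
    (fun r ↦ (hW.measurable r).fst) c d
  let F (e : ℝ) : Set Ω := {ω | (∃ r, (W r ω).1 ∉ Set.Ioo c d) ∧
    W (firstExit c d fun r ↦ (W r ω).1) ω ∈ {e} ×ˢ B}
  have hF (e : ℝ) := measurableSet_past_firstExit hW.continuous c d
    ((measurableSet_singleton e).prod hB)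
  have hFm (e : ℝ) : MeasurableSet (F e) := hW.measurableSet_of_past (hF e)
  have key (e : ℝ) {S : Set Ω} (h : P (F e) ≠ 0 → P[|F e] S ≤ q) : P (F e ∩ S) ≤ q * P (F e) := by
    by_cases h0 : P (F e) = 0
    · exact (measure_mono_null Set.inter_subset_left h0).trans_le zero_le
    · rw [← cond_mul_eq_inter (hFm e)]
      gcongr
      exact h h0
  calc _ ≤ P ((F c ∩ S₁) ∪ (F d ∩ S₂)) := by
        refine measure_mono ?_
        rintro ω ⟨h1, h2, ⟨h3, h4⟩ | ⟨h3, h4⟩⟩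
        · exact .inl ⟨⟨h1, h3, h2⟩, h4⟩
        · exact .inr ⟨⟨h1, h3, h2⟩, h4⟩
    _ ≤ q * P (F c) + q * P (F d) := (measure_union_le _ _).trans (add_le_add
        (key c fun h ↦ (hS _ (hW.after_cond hT (hF c) h)).1)
        (key d fun h ↦ (hS _ (hW.after_cond hT (hF d) h)).2))
    _ = q * P (F c ∪ F d) := by
        rw [measure_union _ (hFm d), mul_add]
        refine Set.disjoint_left.2 fun ω h h' ↦ hcd.ne ?_
        exact h.2.1.symm.trans h'.2.1
    _ ≤ _ := by
        gcongr
        rintro ω (⟨h1, -, h2⟩ | ⟨h1, -, h2⟩) <;> exact ⟨h1, h2⟩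

/-- The path started at some point with real part `u` leaves the strip between the `k`-th
neighbours of the `n`-th slit before it leaves the comb domain. -/
def crosses {Ω : Type*} (x b : ℤ → ℝ) (W : ℝ≥0 → Ω → ℝ × ℝ) (k : ℕ) (n : ℤ) (u : ℝ) : Set Ω :=
  {ω | ∃ v : ℂ, v.re = u ∧ ∃ r, u + (W r ω).1 ∉ Set.Ioo (x (n - k)) (x (n + k)) ∧
    ∀ r' ≤ r, v + toC (W r' ω) ∈ domain x b}

/-- Since `crosses` quantifies over the starting height, the event after `T` involves only the
deterministic abscissa reached. The `k`-window around `n ± 1` lies in the `(k + 1)`-window around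
`n`. -/
theorem crosses_succ {Ω : Type*} {x b : ℤ → ℝ} (hx : StrictMono x) {W : ℝ≥0 → Ω → ℝ × ℝ} {ω : Ω}
    (hc : Continuous (W · ω)) (h0 : W 0 ω = 0) {k : ℕ} {n : ℤ} {u : ℝ}
    (hu : u ∈ Set.Ioo (x (n - 1)) (x (n + 1))) {T : Ω → ℝ≥0}
    (hT : T = fun ω ↦ firstExit (x (n - 1) - u) (x (n + 1) - u) fun r ↦ (W r ω).1)
    (h : ω ∈ crosses x b W (k + 1) n u) :
    (∃ r, (W r ω).1 ∉ Set.Ioo (x (n - 1) - u) (x (n + 1) - u)) ∧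
    (∃ v ∈ domain x b, v.re = u ∧ v + toC (W (T ω) ω) ∈ domain x b) ∧
    (((W (T ω) ω).1 = x (n - 1) - u ∧ ω ∈ crosses x b (after W T) k (n - 1) (x (n - 1))) ∨
     ((W (T ω) ω).1 = x (n + 1) - u ∧ ω ∈ crosses x b (after W T) k (n + 1) (x (n + 1)))) := by
  obtain ⟨v, hv, r, hr, hdom⟩ := h
  have hmem : (W r ω).1 ∉ Set.Ioo (x (n - 1) - u) (x (n + 1) - u) := fun h' ↦ hr
    ⟨(hx.monotone (by push_cast; lia)).trans_lt (sub_lt_iff_lt_add'.1 h'.1),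
      (lt_sub_iff_add_lt'.1 h'.2).trans_le (hx.monotone (by push_cast; lia))⟩
  have hTr : T ω ≤ r := by rw [hT]; exact firstExit_le (f := fun r ↦ (W r ω).1) hmem
  have h00 : (W 0 ω).1 ∈ Set.Ioo (x (n - 1) - u) (x (n + 1) - u) := by
    rw [h0]; exact ⟨sub_neg.2 hu.1, sub_pos.2 hu.2⟩
  have hexit := apply_firstExit (f := fun r ↦ (W r ω).1) hc.fst h00 ⟨r, hmem⟩
  have hT' : firstExit (x (n - 1) - u) (x (n + 1) - u) (fun r ↦ (W r ω).1) = T ω := by rw [hT]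
  rw [hT'] at hexit
  have hv0 : v ∈ domain x b := by
    have := hdom 0 zero_le
    rwa [h0, show toC 0 = 0 from rfl, add_zero] at this
  have cross {e : ℤ} (he : n - (k + 1 : ℕ) ≤ e - k) (he' : e + k ≤ n + (k + 1 : ℕ))
      (hxe : (W (T ω) ω).1 = x e - u) : ω ∈ crosses x b (after W T) k e (x e) := by
    refine ⟨v + toC (W (T ω) ω), by simp [toC, hv, hxe], r - T ω, ?_, fun r' hr' ↦ ?_⟩
    · have : x e + (after W T (r - T ω) ω).1 = u + (W r ω).1 := by
        simp only [after, add_tsub_cancel_of_le hTr, Prod.fst_sub, hxe]; ring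
      rw [this]
      exact fun h' ↦ hr ⟨(hx.monotone he).trans_lt h'.1, h'.2.trans_le (hx.monotone he')⟩
    · have : v + toC (W (T ω) ω) + toC (after W T r' ω) = v + toC (W (T ω + r') ω) := by
        apply Complex.ext <;> simp [toC, after]
      rw [this]
      exact hdom _ ((add_le_add_right hr' _).trans (add_tsub_cancel_of_le hTr).le)
  refine ⟨⟨r, hmem⟩, ⟨v, hv0, hv, hdom _ hTr⟩, ?_⟩
  exact hexit.imp (fun h ↦ ⟨h, cross (by push_cast; lia) (by push_cast; lia) h⟩)
    fun h ↦ ⟨h, cross (by push_cast; lia) (by push_cast; lia) h⟩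

/-- An upper bound for the probability to pass from a slit to one of its neighbours. -/
noncomputable def passBound (ℓ : ℝ) : ℝ≥0∞ :=
  (1 + gaussianReal 0 1 (Set.Ioo (-(6 * (2 * ℓ))) (6 * (2 * ℓ)))) / 2

/-- The induction covers all `P` and `W`, because its hypothesis is applied to the restarted path
under a conditional measure. -/
theorem measure_crosses_le {Ω : Type*} [MeasurableSpace Ω] {x b : ℤ → ℝ} (hx : StrictMono x) {ℓ : ℝ}
    (hℓ : 0 ≤ ℓ)
    (hb : ∀ n, max (b (n - 1)) (b (n + 1)) ≤ ℓ * min (gap x n) (gap x (n + 1))) (k : ℕ) :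
    ∀ {P : Measure Ω} {W : ℝ≥0 → Ω → ℝ × ℝ}, IsContBrownian W P → ∀ n : ℤ,
      P (crosses x b W k n (x n)) ≤ passBound ℓ ^ k := by
  induction k with
  | zero =>
    intro P W hW n
    have := hW.isProbabilityMeasure
    simpa using prob_le_one
  | succ k ih =>
    intro P W hW n
    have h1 : x (n - 1) < x n := hx (by lia)
    have h2 : x n < x (n + 1) := hx (by lia)
    set m := min (gap x n) (gap x (n + 1)) with hm
    have hgap : gap x (n + 1) = x (n + 1) - x n := by simp [gap]
    have hm0 : 0 < m := lt_min (sub_pos.2 h1) (by rw [hgap]; exact sub_pos.2 h2)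
    -- The ratios at `n - 1` and `n + 1` bound `b n` by the gap on either side of `x n`.
    have hbn : b n ≤ ℓ * m := by
      rw [hm, mul_min_of_nonneg _ _ hℓ]
      have e1 := (le_max_right _ _).trans (hb (n - 1))
      have e2 := (le_max_left _ _).trans (hb (n + 1))
      rw [sub_add_cancel, mul_min_of_nonneg _ _ hℓ] at e1
      rw [add_sub_cancel_right, mul_min_of_nonneg _ _ hℓ] at e2
      exact le_min (e1.trans (min_le_right _ _)) (e2.trans (min_le_left _ _))
    have hb1 := (le_max_left _ _).trans (hb n)
    have hb2 := (le_max_right _ _).trans (hb n)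
    have key := hW.measure_firstExit_split_le (sub_lt_sub_right (h1.trans h2) (x n))
      (B := {y | |y| < 2 * ℓ * m}) (measurableSet_lt (by fun_prop) (by fun_prop))
      fun F hF ↦ ⟨ih hF (n - 1), ih hF (n + 1)⟩
    have step := hW.measure_firstExit_le (c := x (n - 1) - x n) (d := x (n + 1) - x n)
      (K := 2 * ℓ) hm0 (by positivity) ((min_le_left _ _).trans (by rw [gap]; linarith))
      ((min_le_right _ _).trans hgap.le)
    rw [pow_succ]
    refine (measure_mono fun ω h ↦ ?_).trans (key.trans (mul_le_mul_right step _))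
    obtain ⟨hex, ⟨v, hv, hvu, hvT⟩, hc⟩ := crosses_succ hx (hW.continuous ω) (hW.zero ω)
      ⟨h1, h2⟩ rfl h
    refine ⟨hex, ?_, hc⟩
    have i1 := abs_lt.1 (abs_im_lt_of_mem_domain hv hvu)
    have i2 : |(v + toC (W (firstExit (x (n - 1) - x n) (x (n + 1) - x n)
        fun r ↦ (W r ω).1) ω)).im| < ℓ * m := by
      rcases hc with ⟨hc, -⟩ | ⟨hc, -⟩
      · exact (abs_im_lt_of_mem_domain hvT (n := n - 1) (by simp [toC, hvu, hc])).trans_le hb1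
      · exact (abs_im_lt_of_mem_domain hvT (n := n + 1) (by simp [toC, hvu, hc])).trans_le hb2
    have i3 (y : ℝ) (h : |v.im + y| < ℓ * m) : |y| < 2 * ℓ * m := by
      have h' := abs_lt.1 h
      exact abs_lt.2 ⟨by linarith [i1.2, h'.1], by linarith [i1.1, h'.2]⟩
    exact i3 _ i2

/-- From a general abscissa, the first passage is bounded by 1 and the remaining `k` start at slits.
-/
theorem measure_crosses_succ_le {Ω : Type*} [MeasurableSpace Ω] {x b : ℤ → ℝ} (hx : StrictMono x)
    {ℓ : ℝ} (hℓ : 0 ≤ ℓ)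
    (hb : ∀ n, max (b (n - 1)) (b (n + 1)) ≤ ℓ * min (gap x n) (gap x (n + 1)))
    {P : Measure Ω} {W : ℝ≥0 → Ω → ℝ × ℝ} (hW : IsContBrownian W P) {n : ℤ} {u : ℝ}
    (hu : u ∈ Set.Ioo (x (n - 1)) (x (n + 1))) (k : ℕ) :
    P (crosses x b W (k + 1) n u) ≤ passBound ℓ ^ k := by
  have := hW.isProbabilityMeasure
  have key := hW.measure_firstExit_split_le (sub_lt_sub_right (hu.1.trans hu.2) u) .univ
    fun F hF ↦ ⟨measure_crosses_le hx hℓ hb k hF (n - 1), measure_crosses_le hx hℓ hb k hF (n + 1)⟩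
  refine (measure_mono fun ω h ↦ ?_).trans (key.trans (mul_le_of_le_one_right' prob_le_one))
  obtain ⟨hex, -, hc⟩ := crosses_succ hx (hW.continuous ω) (hW.zero ω) hu rfl h
  exact ⟨hex, trivial, hc⟩

/-! ### Long stays in an interval -/

/-- A Brownian motion is unlikely to stay for a long time in a bounded interval. -/
theorem measure_forall_mem_Ioo_le {Ω : Type*} [MeasurableSpace Ω] {X : ℝ≥0 → Ω → ℝ} {P : Measure Ω}
    (hX : IsPreBrownianReal X P) {u α β : ℝ} (hαβ : α < β)
    {t : ℝ≥0} {N : ℕ} (ht : N * (β - α) ^ 2 ≤ t) :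
    P {ω | ∀ r ≤ t, u + X r ω ∈ Set.Ioo α β} ≤ gaussianReal 0 1 (Set.Ioo (-1) 1) ^ N := by
  let s : ℝ≥0 := ⟨(β - α) ^ 2, by positivity⟩
  have hs : s ≠ 0 := fun h ↦ (pow_pos (sub_pos.2 hαβ) 2).ne' (congrArg NNReal.toReal h)
  have hmono : Monotone fun j : ℕ ↦ (j : ℝ≥0) * s := fun i j h ↦ by
    have : (i : ℝ≥0) ≤ j := by exact_mod_cast h
    dsimp only; gcongr
  have hind := hX.hasIndepIncrements.nat hmono
  have hmt {j : ℕ} (hj : j ≤ N) : (j : ℝ≥0) * s ≤ t := by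
    refine (hmono hj).trans ?_
    rw [← NNReal.coe_le_coe]
    exact ht
  -- Staying inside forces `N` independent increments, each over time `(β - α) ^ 2`, to be smaller
  -- than the width.
  have hsub : {ω | ∀ r ≤ t, u + X r ω ∈ Set.Ioo α β} ⊆ ⋂ j ∈ Finset.range N,
      {ω | |X ((j + 1 : ℕ) * s) ω - X ((j : ℕ) * s) ω| < β - α} := by
    intro ω h
    refine Set.mem_iInter₂.2 fun j hj ↦ ?_
    have hj := Finset.mem_range.1 hj
    have h1 := h _ (hmt (j := j) hj.le)
    have h2 := h _ (hmt (j := j + 1) hj)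
    have h3 : -(β - α) < X ((j + 1 : ℕ) * s) ω - X ((j : ℕ) * s) ω ∧
        X ((j + 1 : ℕ) * s) ω - X ((j : ℕ) * s) ω < β - α :=
      ⟨by linarith [h1.2, h2.1], by linarith [h1.1, h2.2]⟩
    exact abs_lt.2 h3
  have hprod := (iIndepFun_iff_measure_inter_preimage_eq_mul.1 hind) (Finset.range N)
    (sets := fun _ ↦ {y | |y| < β - α}) fun _ _ ↦ measurableSet_lt (by fun_prop) (by fun_prop)
  refine (measure_mono hsub).trans (hprod.trans_le ?_)
  refine (Finset.prod_le_pow_card _ _ _ fun j _ ↦ ?_).trans_eq (by rw [Finset.card_range])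
  have h := measure_abs_lt_le (hX.shift (j * s)) hs (a := β - α) (K := 1) (by
    rw [one_mul]
    exact (Real.sqrt_sq (sub_pos.2 hαβ).le).ge)
  rw [show (j : ℝ≥0) * s + s = (j + 1 : ℕ) * s by push_cast; ring] at h
  exact h

/-! ### Passing to a continuous measurable version -/

theorem IsPlanarBrownian.exists_isContBrownian {Ω : Type*} [MeasurableSpace Ω] {P : Measure Ω}
    {Z : ℝ≥0 → Ω → ℂ} {z : ℂ} (hZ : IsPlanarBrownian Z z P) :
    ∃ W : ℝ≥0 → Ω → ℝ × ℝ, IsContBrownian W P ∧ ∀ᵐ ω ∂P, ∀ t, Z t ω = z + toC (W t ω) := by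
  let V (t : ℝ≥0) (ω : Ω) : ℝ × ℝ := ((Z t ω - z).re, (Z t ω - z).im)
  have hV (t : ℝ≥0) : AEMeasurable (V t) P := (hZ.re.aemeasurable t).prodMk (hZ.im.aemeasurable t)
  let e := TopologicalSpace.denseSeq ℝ≥0
  have good : ∀ᵐ ω ∂P, Continuous (V · ω) ∧ V 0 ω = 0 ∧ ∀ i, V (e i) ω = (hV (e i)).mk _ ω := by
    filter_upwards [hZ.re.cont, hZ.im.cont, hZ.re.eval_zero_ae_eq_zero, hZ.im.eval_zero_ae_eq_zero,
      ae_all_iff.2 fun i ↦ (hV (e i)).ae_eq_mk] with ω h1 h2 h3 h4 h5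
    exact ⟨h1.prodMk h2, Prod.ext h3 h4, h5⟩
  obtain ⟨G, hGsub, hGm, hG0⟩ := exists_measurable_superset_of_null (ae_iff.1 good)
  have hgood {ω : Ω} (h : ω ∉ G) := not_not.1 (mt (@hGsub ω) h)
  have hGc : ∀ᵐ ω ∂P, ω ∉ G := measure_eq_zero_iff_ae_notMem.1 hG0
  let W (t : ℝ≥0) : Ω → ℝ × ℝ := Gᶜ.indicator (V t)
  have hWV : ∀ᵐ ω ∂P, ∀ t, V t ω = W t ω := by
    filter_upwards [hGc] with ω h t
    exact (Set.indicator_of_mem (Set.mem_compl h) _).symm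
  have hWc (ω : Ω) : Continuous (W · ω) := by
    by_cases h : ω ∈ G
    · simp only [W, Set.indicator_of_notMem (Set.notMem_compl_iff.2 h)]
      exact continuous_const
    · simp only [W, Set.indicator_of_mem (Set.mem_compl h)]
      exact (hgood h).1
  -- Measurability holds on a dense sequence of times and extends to all times by continuity.
  have hWe (i : ℕ) : Measurable (W (e i)) := by
    have : W (e i) = Gᶜ.indicator ((hV (e i)).mk _) := by
      ext1 ω
      by_cases h : ω ∈ G
      · simp [W, h]
      · simp only [W, Set.indicator_of_mem (Set.mem_compl h), (hgood h).2.2 i]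
    rw [this]
    exact (hV (e i)).measurable_mk.indicator hGm.compl
  refine ⟨W, ⟨fun t ↦ ?_, hWc, fun ω ↦ ?_, ?_, ?_, ?_⟩, ?_⟩
  · obtain ⟨u, hu, hut⟩ := mem_closure_iff_seq_limit.1 (TopologicalSpace.denseRange_denseSeq ℝ≥0 t)
    refine measurable_of_tendsto_metrizable (f := fun n ↦ W (u n)) (fun n ↦ ?_)
      (tendsto_pi_nhds.2 fun ω ↦ ((hWc ω).tendsto t).comp hut)
    obtain ⟨i, hi⟩ := hu n
    exact hi ▸ hWe i
  · by_cases h : ω ∈ G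
    · simp [W, h]
    · simp only [W, Set.indicator_of_mem (Set.mem_compl h), (hgood h).2.1]
  · exact hZ.re.toIsPreBrownianReal.congr fun t ↦ hWV.mono fun ω h ↦ congrArg Prod.fst (h t)
  · exact hZ.im.toIsPreBrownianReal.congr fun t ↦ hWV.mono fun ω h ↦ congrArg Prod.snd (h t)
  · exact hZ.indep.congr (hWV.mono fun ω h ↦ funext fun t ↦ congrArg Prod.fst (h t))
      (hWV.mono fun ω h ↦ funext fun t ↦ congrArg Prod.snd (h t))
  · filter_upwards [hWV] with ω h t
    rw [← h t]
    apply Complex.ext <;> simp [V, toC]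

/-! ### Geometry of the comb -/

/-- Otherwise the supremum of the sequence would be an accumulation point. -/
theorem IsComb.exists_lt {x b : ℤ → ℝ} (h : IsComb x b) (u : ℝ) : ∃ n, u < x n := by
  by_contra! hu
  have hbdd : BddAbove (Set.range x) := ⟨u, Set.forall_mem_range.2 hu⟩
  have lim := tendsto_atTop_ciSup h.strictMono.monotone hbdd
  refine h.not_accPt (⨆ i, x i) (accPt_iff_nhds.2 fun U hU ↦ ?_)
  obtain ⟨n, hn⟩ := (lim.eventually hU).exists
  exact ⟨x n, ⟨hn, n, rfl⟩, ((h.strictMono (lt_add_one n)).trans_le (le_ciSup hbdd (n + 1))).ne⟩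

theorem IsComb.exists_gt {x b : ℤ → ℝ} (h : IsComb x b) (u : ℝ) : ∃ n, x n < u := by
  by_contra! hu
  have hbdd : BddBelow (Set.range x) := ⟨u, Set.forall_mem_range.2 hu⟩
  have lim := tendsto_atBot_ciInf h.strictMono.monotone hbdd
  refine h.not_accPt (⨅ i, x i) (accPt_iff_nhds.2 fun U hU ↦ ?_)
  obtain ⟨n, hn⟩ := (lim.eventually hU).exists
  exact ⟨x n, ⟨hn, n, rfl⟩,
    ((ciInf_le hbdd (n - 1)).trans_lt (h.strictMono (sub_one_lt n))).ne'⟩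

theorem IsComb.exists_mem_Ioo {x b : ℤ → ℝ} (h : IsComb x b) (u : ℝ) :
    ∃ n, u ∈ Set.Ioo (x (n - 1)) (x (n + 1)) := by
  obtain ⟨m, hm⟩ := h.exists_gt u
  obtain ⟨M, hM⟩ := h.exists_lt u
  obtain ⟨n, hn, hmax⟩ := Int.exists_greatest_of_bdd (P := fun n ↦ x n ≤ u)
    ⟨M, fun n hn ↦ (h.strictMono.lt_iff_lt.1 (hn.trans_lt hM)).le⟩ ⟨m, hm.le⟩
  refine ⟨n, (h.strictMono (sub_one_lt n)).trans_le hn, ?_⟩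
  by_contra! hlt
  exact absurd (hmax _ hlt) (by lia)

theorem IsComb.max_le {x b : ℤ → ℝ} (h : IsComb x b) {ℓ : ℝ}
    (hℓ : ℓ ∈ upperBounds (Set.range (ratio x b))) (n : ℤ) :
    max (b (n - 1)) (b (n + 1)) ≤ ℓ * min (gap x n) (gap x (n + 1)) := by
  refine (div_le_iff₀ (lt_min (sub_pos.2 ?_) (sub_pos.2 ?_))).1 (hℓ ⟨n, rfl⟩)
  · exact h.strictMono (sub_one_lt n)
  · exact h.strictMono (sub_one_lt _)

theorem IsComb.pos_of_mem_upperBounds {x b : ℤ → ℝ} (h : IsComb x b) {ℓ : ℝ}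
    (hℓ : ℓ ∈ upperBounds (Set.range (ratio x b))) : 0 < ℓ := by
  refine (div_pos ((h.pos (0 + 1)).trans_le (le_max_right _ _)) (lt_min ?_ ?_)).trans_le
    (hℓ ⟨0, rfl⟩)
  · exact sub_pos.2 (h.strictMono (sub_one_lt _))
  · exact sub_pos.2 (h.strictMono (sub_one_lt _))

theorem sub_le_mul_of_gap_le {x : ℤ → ℝ} {a : ℤ} {g : ℝ} (m : ℕ)
    (h : ∀ i : ℤ, a < i → i ≤ a + m → gap x i ≤ g) : x (a + m) - x a ≤ m * g := by
  induction m with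
  | zero => simp
  | succ m ih =>
    have h1 := ih fun i hi hi' ↦ h i hi (by push_cast; lia)
    have h2 := h (a + (m + 1 : ℕ)) (by push_cast; lia) le_rfl
    rw [gap, show a + ((m + 1 : ℕ) : ℤ) - 1 = a + m by push_cast; ring] at h2
    push_cast at *
    linarith

theorem sq_sub_le_maxGapSq {x : ℤ → ℝ} (hx : StrictMono x) (n : ℤ) (k : ℕ) :
    (x (n + (k + 1 : ℕ)) - x (n - (k + 1 : ℕ))) ^ 2 ≤
      4 * (k + 1) ^ 2 * maxGapSq x (k + n.natAbs + 1) := by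
  have hgap (i : ℤ) : 0 < gap x i := sub_pos.2 (hx (sub_one_lt i))
  have hle (i : ℤ) (hi : n - (k + 1 : ℕ) < i) (hi' : i ≤ n - (k + 1 : ℕ) + (2 * (k + 1) : ℕ)) :
      gap x i ≤ √(maxGapSq x (k + n.natAbs + 1)) := by
    refine Real.le_sqrt_of_sq_le (Finset.le_sup' (fun i ↦ gap x i ^ 2) (Finset.mem_Icc.2 ?_))
    constructor <;> omega
  have h := sub_le_mul_of_gap_le (2 * (k + 1)) hle
  rw [show n - ((k + 1 : ℕ) : ℤ) + (2 * (k + 1) : ℕ) = n + (k + 1 : ℕ) by push_cast; ring] at h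
  have h0 : 0 ≤ maxGapSq x (k + n.natAbs + 1) :=
    (sq_nonneg (gap x 0)).trans (Finset.le_sup' (fun i ↦ gap x i ^ 2) (Finset.mem_Icc.2 (by omega)))
  have hpos : 0 ≤ x (n + (k + 1 : ℕ)) - x (n - (k + 1 : ℕ)) :=
    sub_nonneg.2 (hx.monotone (by lia))
  calc _ ≤ (((2 * (k + 1) : ℕ) : ℝ) * √(maxGapSq x (k + n.natAbs + 1))) ^ 2 := by gcongr
    _ = _ := by rw [mul_pow, Real.sq_sqrt h0]; push_cast; ring

/-! ### Tail and moments of the exit time -/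

theorem mem_of_lt_exitTime {Ω : Type*} {Z : ℝ≥0 → Ω → ℂ} {U : Set ℂ} {ω : Ω} {t r : ℝ≥0}
    (h : (t : ℝ≥0∞) < exitTime Z U ω) (hr : r ≤ t) : Z r ω ∈ U := by
  by_contra hU
  have h1 : hittingAfter Z Uᶜ 0 ω ≤ (r : WithTop ℝ≥0) := hittingAfter_le_of_mem zero_le hU
  exact absurd (h.trans_le (h1 : exitTime Z U ω ≤ (r : ℝ≥0∞))) (by simpa using hr)

/-- By time `t` the real part either has left the window, which needs `k + 1` passages, or has
stayed in it throughout. -/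
theorem measure_lt_exitTime_le {Ω : Type*} [MeasurableSpace Ω] {x b : ℤ → ℝ} (hx : StrictMono x)
    {ℓ : ℝ} (hℓ : 0 ≤ ℓ)
    (hb : ∀ n, max (b (n - 1)) (b (n + 1)) ≤ ℓ * min (gap x n) (gap x (n + 1)))
    {P : Measure Ω} {Z : ℝ≥0 → Ω → ℂ} {z : ℂ} (hZ : IsPlanarBrownian Z z P) {n : ℤ}
    (hz : z.re ∈ Set.Ioo (x (n - 1)) (x (n + 1))) (k N : ℕ) {t : ℝ≥0}
    (ht : N * (x (n + (k + 1 : ℕ)) - x (n - (k + 1 : ℕ))) ^ 2 ≤ t) :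
    P {ω | (t : ℝ≥0∞) < exitTime Z (domain x b) ω} ≤
      passBound ℓ ^ k + gaussianReal 0 1 (Set.Ioo (-1) 1) ^ N := by
  obtain ⟨W, hW, hZW⟩ := hZ.exists_isContBrownian
  refine (measure_mono_ae (t := crosses x b W (k + 1) n z.re ∪ {ω | ∀ r ≤ t, z.re + (W r ω).1 ∈
    Set.Ioo (x (n - (k + 1 : ℕ))) (x (n + (k + 1 : ℕ)))}) ?_).trans
    ((measure_union_le _ _).trans (add_le_add (measure_crosses_succ_le hx hℓ hb hW hz k)
      (measure_forall_mem_Ioo_le hW.fst (hx (by lia)) ht)))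
  filter_upwards [hZW] with ω hω h
  by_cases hstay : ∀ r ≤ t, z.re + (W r ω).1 ∈ Set.Ioo (x (n - (k + 1 : ℕ))) (x (n + (k + 1 : ℕ)))
  · exact .inr hstay
  · push Not at hstay
    obtain ⟨r, hr, hr'⟩ := hstay
    refine .inl ⟨z, rfl, r, hr', fun r' hr'' ↦ ?_⟩
    rw [← hω]
    exact mem_of_lt_exitTime h (hr''.trans hr)

theorem lintegral_rpow_lt_top_of_tsum {Ω : Type*} [MeasurableSpace Ω] {P : Measure Ω}
    [IsFiniteMeasure P] {τ : Ω → ℝ≥0∞} {t : ℕ → ℝ≥0} (ht : ∀ k, 1 ≤ t k) {p : ℝ} (hp : 0 < p)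
    (h : ∑' k, (t (k + 1) : ℝ≥0∞) ^ p * P {ω | (t k : ℝ≥0∞) < τ ω} ≠ ∞) :
    ∫⁻ ω, τ ω ^ p ∂P < ∞ := by
  -- Measurable hulls make the argument independent of the measurability of `τ`.
  let A (k : ℕ) : Set Ω := toMeasurable P {ω | (t k : ℝ≥0∞) < τ ω}
  have hA (k : ℕ) : MeasurableSet (A k) := measurableSet_toMeasurable _ _
  have bound (ω : Ω) : τ ω ^ p ≤ (t 0 : ℝ≥0∞) ^ p +
      ∑' k, (A k).indicator (fun _ ↦ (t (k + 1) : ℝ≥0∞) ^ p) ω := by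
    have hmem {k : ℕ} (h : (t k : ℝ≥0∞) < τ ω) : ω ∈ A k := subset_toMeasurable _ _ h
    by_cases hall : ∀ k, (t k : ℝ≥0∞) < τ ω
    · have : ∑' k, (A k).indicator (fun _ ↦ (t (k + 1) : ℝ≥0∞) ^ p) ω = ∞ := by
        refine top_le_iff.1 ?_
        rw [← ENNReal.tsum_const_eq_top_of_ne_zero (α := ℕ) one_ne_zero]
        refine ENNReal.tsum_le_tsum fun k ↦ ?_
        rw [Set.indicator_of_mem (hmem (hall k))]
        exact ENNReal.one_le_rpow (by exact_mod_cast ht _) hp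
      simp [this]
    · push Not at hall
      classical
      have hspec := Nat.find_spec hall
      rcases hfind : Nat.find hall with _ | j
      · rw [hfind] at hspec
        exact (ENNReal.rpow_le_rpow hspec hp.le).trans le_self_add
      · rw [hfind] at hspec
        have hj : (t j : ℝ≥0∞) < τ ω := not_le.1 (Nat.find_min hall (by lia))
        calc τ ω ^ p ≤ (t (j + 1) : ℝ≥0∞) ^ p := ENNReal.rpow_le_rpow hspec hp.le
          _ = (A j).indicator (fun _ ↦ (t (j + 1) : ℝ≥0∞) ^ p) ω :=
              (Set.indicator_of_mem (hmem hj) (fun _ ↦ (t (j + 1) : ℝ≥0∞) ^ p)).symm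
          _ ≤ _ := (ENNReal.le_tsum j).trans le_add_self
  refine (lintegral_mono bound).trans_lt ?_
  rw [lintegral_add_left measurable_const, lintegral_const,
    lintegral_tsum fun k ↦ (measurable_const.indicator (hA k)).aemeasurable]
  simp_rw [lintegral_indicator_const (hA _), A, measure_toMeasurable]
  refine ENNReal.add_lt_top.2 ⟨ENNReal.mul_lt_top ?_ (measure_lt_top _ _), h.lt_top⟩
  exact ENNReal.rpow_lt_top_of_nonneg hp.le ENNReal.coe_ne_top

theorem pow_three_rpow_le {K p : ℝ} (hK : 1 ≤ K) {m : ℕ} (hm : 3 * p ≤ m) : (K ^ 3) ^ p ≤ K ^ m := by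
  rw [← Real.rpow_natCast K m, ← Real.rpow_natCast K 3, ← Real.rpow_mul (by positivity)]
  exact Real.rpow_le_rpow_of_exponent_le hK (by push_cast; exact hm)

theorem summable_rpow_mul_pow {C θ p : ℝ} (hC : 0 ≤ C) (hθ : 0 < θ) (hθ1 : θ < 1) (hp : 0 < p) :
    Summable fun k : ℕ ↦
      (C * ((k + 1 : ℕ) + 1) ^ 3 * θ ^ (-((k + 1 : ℕ) / p))) ^ p * (θ ^ 2) ^ k := by
  obtain ⟨m, hm⟩ := exists_nat_ge (3 * p)
  have hs : Summable fun k : ℕ ↦ ((k + 2 : ℕ) : ℝ) ^ m * θ ^ (k + 2) :=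
    (summable_nat_add_iff (f := fun k : ℕ ↦ (k : ℝ) ^ m * θ ^ k) 2).2
      (summable_pow_mul_geometric_of_norm_lt_one m (by rwa [Real.norm_of_nonneg hθ.le]))
  refine (hs.mul_left (C ^ p * (θ ^ 3)⁻¹)).of_nonneg_of_le (fun k ↦ by positivity) fun k ↦ ?_
  have e : (((k + 1 : ℕ) : ℝ) + 1) = ((k + 2 : ℕ) : ℝ) := by push_cast; ring
  have e1 : (θ ^ (-((k + 1 : ℕ) / p))) ^ p = (θ ^ (k + 1))⁻¹ := by
    rw [← Real.rpow_mul hθ.le, neg_mul, div_mul_cancel₀ _ hp.ne', Real.rpow_neg hθ.le,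
      Real.rpow_natCast]
  have hK : (1 : ℝ) ≤ ((k + 2 : ℕ) : ℝ) := Nat.one_le_cast.2 (Nat.le_add_left 1 (k + 1))
  have e3 : (θ ^ (k + 1))⁻¹ * (θ ^ 2) ^ k = (θ ^ 3)⁻¹ * θ ^ (k + 2) := by
    field_simp
    ring
  rw [e]
  generalize ((k + 2 : ℕ) : ℝ) = K at hK
  rw [Real.mul_rpow (by positivity) (by positivity), Real.mul_rpow hC (by positivity), e1]
  calc C ^ p * (K ^ 3) ^ p * (θ ^ (k + 1))⁻¹ * (θ ^ 2) ^ k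
      = C ^ p * (K ^ 3) ^ p * ((θ ^ (k + 1))⁻¹ * (θ ^ 2) ^ k) := by ring
    _ ≤ C ^ p * K ^ m * ((θ ^ (k + 1))⁻¹ * (θ ^ 2) ^ k) := by
        gcongr
        exact pow_three_rpow_le hK hm
    _ = C ^ p * (θ ^ 3)⁻¹ * (K ^ m * θ ^ (k + 2)) := by rw [e3]; ring

theorem exists_maxGapSq_le {x : ℤ → ℝ} {θ p : ℝ} (hθ : 0 < θ)
    (h : Summable fun j : ℕ ↦ maxGapSq x (j + 1) * θ ^ (((j + 1 : ℕ) : ℝ) / p)) (n : ℕ) :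
    ∃ C : ℝ, 0 ≤ C ∧ ∀ k : ℕ, maxGapSq x (k + n + 1) ≤ C * θ ^ (-(k / p)) := by
  obtain ⟨C, hC⟩ := h.tendsto_atTop_zero.bddAbove_range
  have hC (j : ℕ) : maxGapSq x (j + 1) * θ ^ (((j + 1 : ℕ) : ℝ) / p) ≤ max C 0 :=
    (hC ⟨j, rfl⟩).trans (le_max_left _ _)
  refine ⟨max C 0 * θ ^ (-((n + 1) / p)), by positivity, fun k ↦ ?_⟩
  have h1 := hC (k + n)
  rw [← le_div_iff₀ (by positivity), div_eq_mul_inv, ← Real.rpow_neg hθ.le] at h1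
  refine h1.trans_eq ?_
  rw [mul_assoc, ← Real.rpow_add hθ]
  congr 2
  push_cast
  ring

/-- A number in `(0, 1)` that dominates `passBound ℓ` and the standard normal mass of `(-1, 1)`. -/
noncomputable def rate (ℓ : ℝ) : ℝ≥0∞ := max (passBound ℓ) (gaussianReal 0 1 (Set.Ioo (-1) 1))

theorem rate_lt_one (ℓ : ℝ) : rate ℓ < 1 := by
  refine max_lt ?_ (gaussianReal_Ioo_lt_one 1)
  have h := gaussianReal_Ioo_lt_one (6 * (2 * ℓ))
  have h2 : 1 + gaussianReal 0 1 (Set.Ioo (-(6 * (2 * ℓ))) (6 * (2 * ℓ))) < 2 := by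
    refine lt_of_lt_of_eq ?_ one_add_one_eq_two
    exact ENNReal.add_lt_add_left ENNReal.one_ne_top h
  refine (ENNReal.div_lt_iff (.inl (by simp)) (.inl (by simp))).2 ?_
  rwa [one_mul]

theorem rate_pos (ℓ : ℝ) : 0 < rate ℓ :=
  lt_max_of_lt_left (ENNReal.div_pos (by simp) (by simp))

theorem lintegral_exitTime_rpow_lt_top {x b : ℤ → ℝ} (h : IsComb x b) {ℓ : ℝ}
    (hℓ : ℓ ∈ upperBounds (Set.range (ratio x b))) {p : ℝ} (hp : 0 < p)
    {θ : ℝ} (hθ : 0 < θ) (hθ1 : θ < 1) (hr : rate ℓ ≤ ENNReal.ofReal (θ ^ 2))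
    (hsum : Summable fun j : ℕ ↦ maxGapSq x (j + 1) * θ ^ (((j + 1 : ℕ) : ℝ) / p))
    {Ω : Type*} [MeasurableSpace Ω] {P : Measure Ω} [IsProbabilityMeasure P]
    {z : ℂ} {Z : ℝ≥0 → Ω → ℂ} (hZ : IsPlanarBrownian Z z P) :
    ∫⁻ ω, exitTime Z (domain x b) ω ^ p ∂P < ∞ := by
  obtain ⟨n, hn⟩ := h.exists_mem_Ioo z.re
  obtain ⟨C, hC0, hC⟩ := exists_maxGapSq_le hθ hsum n.natAbs
  have hC' : 0 ≤ 4 * C + 1 := by positivity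
  -- `k` times the squared window width is at most `4 * C * (k + 1) ^ 3 * θ ^ (-(k / p))`; the extra
  -- `1` ensures `1 ≤ t k`.
  let t (k : ℕ) : ℝ≥0 := ⟨(4 * C + 1) * (k + 1) ^ 3 * θ ^ (-(k / p)), by positivity⟩
  have ht (k : ℕ) : (t k : ℝ) = (4 * C + 1) * (k + 1) ^ 3 * θ ^ (-(k / p)) := rfl
  have hθk (k : ℕ) : 1 ≤ θ ^ (-(k / p)) :=
    Real.one_le_rpow_of_pos_of_le_one_of_nonpos hθ hθ1.le (neg_nonpos.2 (by positivity))
  refine lintegral_rpow_lt_top_of_tsum (t := t) (fun k ↦ ?_) hp ?_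
  · rw [← NNReal.coe_le_coe, ht, NNReal.coe_one]
    have h1 : (1 : ℝ) ≤ (k + 1) ^ 3 := one_le_pow₀ (by linarith [(Nat.cast_nonneg k : (0 : ℝ) ≤ k)])
    exact one_le_mul_of_one_le_of_one_le
      (one_le_mul_of_one_le_of_one_le (by linarith) h1) (hθk k)
  have tail (k : ℕ) : P {ω | (t k : ℝ≥0∞) < exitTime Z (domain x b) ω} ≤
      2 * ENNReal.ofReal (θ ^ 2) ^ k := by
    refine (measure_lt_exitTime_le h.strictMono (h.pos_of_mem_upperBounds hℓ).le (h.max_le hℓ) hZ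
      hn k k ?_).trans ?_
    · rw [ht]
      calc k * (x (n + (k + 1 : ℕ)) - x (n - (k + 1 : ℕ))) ^ 2
          ≤ (k + 1) * (4 * (k + 1) ^ 2 * (C * θ ^ (-(k / p)))) := by
            gcongr
            · linarith
            · refine (sq_sub_le_maxGapSq h.strictMono n k).trans ?_
              gcongr
              exact hC k
        _ = 4 * C * (k + 1) ^ 3 * θ ^ (-(k / p)) := by ring
        _ ≤ _ := by gcongr; linarith
    · rw [two_mul]
      gcongr
      · exact (le_max_left _ _).trans hr
      · exact (le_max_right _ _).trans hr
  have hs := (summable_rpow_mul_pow hC' hθ hθ1 hp).mul_left 2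
  refine ne_top_of_le_ne_top (hs.tsum_ofReal_ne_top) (ENNReal.tsum_le_tsum fun k ↦ ?_)
  refine (mul_le_mul_right (tail k) _).trans_eq ?_
  rw [ENNReal.ofReal_mul (by norm_num), ENNReal.ofReal_mul (by positivity),
    ← ENNReal.ofReal_rpow_of_nonneg (by positivity) hp.le, ← ENNReal.ofReal_pow (by positivity),
    ← ht, ENNReal.ofReal_coe_nnreal, ENNReal.ofReal_ofNat]
  ring

end Comb

theorem mainTheorem1 (ℓ : ℝ) :
    ∃ θ₀ : ℝ, 0 < θ₀ ∧ θ₀ < 1 ∧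
      ∀ x b : ℤ → ℝ, Comb.IsComb x b → x 0 = 0 →
        IsLUB (Set.range (Comb.ratio x b)) ℓ →
        ∀ p : ℝ, 0 < p →
          Summable (fun j : ℕ ↦ Comb.maxGapSq x (j + 1) * θ₀ ^ (((j + 1 : ℕ) : ℝ) / p)) →
          ∀ (Ω : Type*) [MeasurableSpace Ω] (P : Measure Ω) [IsProbabilityMeasure P]
            (z : ℂ) (Z : ℝ≥0 → Ω → ℂ),
            z ∈ Comb.domain x b → Comb.IsPlanarBrownian Z z P →
            ∫⁻ ω, Comb.exitTime Z (Comb.domain x b) ω ^ p ∂P < ∞ := by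
  have htop : Comb.rate ℓ ≠ ∞ := (Comb.rate_lt_one ℓ).ne_top
  have hpos : 0 < (Comb.rate ℓ).toReal := ENNReal.toReal_pos (Comb.rate_pos ℓ).ne' htop
  have hlt : (Comb.rate ℓ).toReal < 1 := by
    simpa using (ENNReal.toReal_lt_toReal htop ENNReal.one_ne_top).2 (Comb.rate_lt_one ℓ)
  -- With the square root, `rate ℓ ^ k = θ₀ ^ (2 * k)`: one factor `θ₀ ^ k` cancels the growth of `t
  -- k ^ p`, the other gives convergence.
  refine ⟨√(Comb.rate ℓ).toReal, Real.sqrt_pos.2 hpos, (Real.sqrt_lt' one_pos).2 (by simpa),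
    fun x b h _ hℓ p hp hsum Ω _ P _ z Z _ hZ ↦ ?_⟩
  refine Comb.lintegral_exitTime_rpow_lt_top h hℓ.1 hp (Real.sqrt_pos.2 hpos)
    ((Real.sqrt_lt' one_pos).2 (by simpa)) ?_ hsum hZ
  rw [Real.sq_sqrt hpos.le, ENNReal.ofReal_toReal htop]
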